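/- Consider the synchronous $\mathsf{CONGEST}$ model with sleeping nodes. The network is a finite simple graph whose nodes have distinct identifiers; initially a node knows its own identifier, those of its neighbors, and two global parameters $N$ and $\Delta$, and it has private random bits, independent of those of the other nodes. In every round each node is awake or asleep; an awake node may send one message of $O(\log N)$ bits to each neighbor, and it is received if that neighbor is awake in the same round. Local computation is free. A sleeping node does nothing, receives nothing, and wakes up only at a time which it has scheduled itself. For a set $S$ of nodes of a graph $G$, write $G\setminus N[S]$ for the graph obtained from $G$ by removing all nodes of $S$ and all their neighbors. Below, $N\ge 3$, and $G$ is an arbitrary graph with at most $N$ nodes and maximum degree at most $\Delta$, with arbitrary distinct identifiers. (In particular, $N$ and $\Delta$ may be the exact number of nodes and the exact maximum degree.) All constants are absolute. **Lemma.** There are constants $c,C>0$ and a randomized distributed algorithm such that, whenever $\Delta\ge c\log^{20}N$, the following holds on every such $G$. In every execution the algorithm uses messages of at most $C\log N$ bits, terminates within $C\log N$ rounds, keeps each node awake in at most $C\log\log N$ rounds, and computes an independent set $S$ of $G$. With probability at least $1-N^{-6}$, the graph $G\setminus N[S]$ has maximum degree at most $\Delta^{0.7}$. **Corollary.** There are a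 constant $C>0$ and a randomized distributed algorithm such that, whenever $\Delta\ge 3$, the following holds on every such $G$. In every execution the algorithm uses messages of at most $C\log N$ bits, terminates within $C\log N\cdot\log\log\Delta$ rounds, keeps each node awake in at most $C\log\log N\cdot\log\log\Delta$ rounds, and computes an independent set $S$ of $G$. With probability at least $1-N^{-5}$, the graph $G\setminus N[S]$ has maximum degree at most $C\log^{20}N$. -/

import Mathlib

open MeasureTheory

/-- A randomized distributed algorithm in the synchronous `CONGEST` model in which nodes may sleep.
Local computation is unbounded, as usual in this model.  All nodes run the same code. -/
structure SleepingAlgorithm where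
  /-- The outcomes of the private randomness of one node. -/
  Seed : Type
  seedCountable : Countable Seed
  /-- The law of the private randomness of one node. -/
  coin : PMF Seed
  /-- The number of bits in one message. -/
  bandwidth : ℕ
  /-- The local states (memory contents) of a node. -/
  State : Type
  /-- The initial state, computed from the node's own identifier, the identifiers of its
  neighbours, and its private randomness. -/
  init : ℕ → Set ℕ → Seed → State
  /-- Evaluated in the initial state and in the state at the end of every awake round.
  `some k`: the node sleeps through the next `k` rounds and is awake in the one after them
  (`k = 0`: it is awake in the next round).  `none`: the node terminates. -/
  sleep : State → Option ℕ
  /-- The message that an awake node sends to the neighbour with the given identifier, if any. -/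
  send : State → ℕ → Option (BitVec bandwidth)
  /-- The state at the end of an awake round, computed from the previous state and the set of all
  pairs (identifier of the sender, message) received in this round. -/
  step : State → Set (ℕ × BitVec bandwidth) → State
  /-- Whether the node belongs to the computed set. -/
  output : State → Bool

namespace SleepingAlgorithm

instance (A : SleepingAlgorithm) : MeasurableSpace A.Seed := ⊤

/-- The local situation of a node between two rounds: its state, and the number of the next round
in which it is awake (`none` once it has terminated).  Rounds are numbered `0, 1, 2, …`. -/
structure Local (A : SleepingAlgorithm) where
  state : A.State
  wake : Option ℕ

variable {V : Type}

/-- The messages received by `v` in round `r`, if `v` is awake in it: those that were sent to `v` by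
its neighbours that are awake in round `r`. -/
def inbox (A : SleepingAlgorithm) (G : SimpleGraph V) (ident : V → ℕ) (r : ℕ) (c : V → A.Local)
    (v : V) : Set (ℕ × BitVec A.bandwidth) :=
  {p | ∃ u, G.Adj v u ∧ (c u).wake = some r ∧ p.1 = ident u ∧
    A.send (c u).state (ident v) = some p.2}

/-- The situation of all nodes at the beginning of round `r` (after rounds `0, …, r - 1`), when node
`v` has identifier `ident v` and private randomness `ω v`. -/
def config (A : SleepingAlgorithm) (G : SimpleGraph V) (ident : V → ℕ) (ω : V → A.Seed) :
    ℕ → V → A.Local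
  | 0 => fun v =>
      let s := A.init (ident v) (ident '' G.neighborSet v) (ω v)
      ⟨s, A.sleep s⟩
  | r + 1 => fun v =>
      let c := config A G ident ω r
      if (c v).wake = some r then
        let s := A.step (c v).state (A.inbox G ident r c v)
        ⟨s, (A.sleep s).map (fun k => r + 1 + k)⟩
      else c v

/-- Node `v` is awake in round `r`. -/
def Awake (A : SleepingAlgorithm) (G : SimpleGraph V) (ident : V → ℕ) (ω : V → A.Seed)
    (r : ℕ) (v : V) : Prop :=
  (A.config G ident ω r v).wake = some r

open Classical in
/-- The number of rounds among the first `T` ones in which `v` is awake. -/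
noncomputable def awakeRounds (A : SleepingAlgorithm) (G : SimpleGraph V) (ident : V → ℕ)
    (ω : V → A.Seed) (T : ℕ) (v : V) : ℕ :=
  ((Finset.range T).filter (fun r => A.Awake G ident ω r v)).card

/-- The set of nodes that consider themselves members of the output after `T` rounds. -/
def outputSet (A : SleepingAlgorithm) (G : SimpleGraph V) (ident : V → ℕ) (ω : V → A.Seed)
    (T : ℕ) : Set V :=
  {v | A.output (A.config G ident ω T v).state = true}

/-- The joint law of the private randomness: independent copies of `coin`, one for each node. -/
noncomputable def law (A : SleepingAlgorithm) (V : Type) [Fintype V] : Measure (V → A.Seed) :=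
  Measure.pi (fun _ => A.coin.toMeasure)

end SleepingAlgorithm

/-- The nodes that are left when the nodes in `S` and all their neighbours are removed. -/
def remainingNodes {V : Type} (G : SimpleGraph V) (S : Set V) : Set V :=
  {v | v ∉ S ∧ ∀ u ∈ S, ¬ G.Adj v u}

open Classical in
/-- On every graph with at most `N` nodes and maximum degree at most `Δ`, and for every assignment of
distinct identifiers, `A` exchanges messages of at most `bits` bits, terminates within `rounds`
rounds, lets every node be awake in at most `energy` rounds, and outputs an independent set (all of
this in every execution); and with probability at least `prob`, the removal of this set and of its
neighbours leaves a graph of maximum degree at most `deg`. -/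
def ReducesDegree (A : SleepingAlgorithm) (N Δ : ℕ) (bits rounds energy prob deg : ℝ) : Prop :=
  (A.bandwidth : ℝ) ≤ bits ∧
  ∀ (V : Type) [Fintype V] (G : SimpleGraph V) (ident : V → ℕ),
    Fintype.card V ≤ N → G.maxDegree ≤ Δ → Function.Injective ident →
    (∀ ω : V → A.Seed,
      (∀ v, (A.config G ident ω ⌊rounds⌋₊ v).wake = none) ∧
      (∀ v, (A.awakeRounds G ident ω ⌊rounds⌋₊ v : ℝ) ≤ energy) ∧
      G.IsIndepSet (A.outputSet G ident ω ⌊rounds⌋₊)) ∧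
    prob ≤ (A.law V).real {ω |
      ((G.induce (remainingNodes G (A.outputSet G ident ω ⌊rounds⌋₊))).maxDegree : ℝ) ≤ deg}

/-! The algorithm is Luby's, sampled and put to sleep. A phase has T = 2^L = Θ(log N) steps and a
target degree D. In each phase a node competes only in the first step in which its uniform b-bit
value falls below 2^b / D. It joins if no neighbour has joined and its value is strictly below that
of every competing neighbour without a joined neighbour.

Progress: Luby's edge count is restricted to remaining nodes v with degree d(v) ≥ D. If a neighbour
u of v draws a value below 2^b / (2(d(u)+d(v))) and the other unused neighbours of u and v do not,
then u joins and v disappears. This cutoff lies below 2^b / D, so sampling loses no such event.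
Hence the degree sum shrinks by 31/32 in expectation (`expect_highDegreeSum_step`), as long as at
most D/4 remaining neighbours of each remaining node are used up. At most about TΔ/D neighbours are
sampled in a phase on average, so 64TΔ ≤ D² makes this likely, by an exponential moment.
`expect_phase_failure` combines the two bounds.

Energy: a node hit at step t must learn of joins before t and announce its own join to nodes hit
later. It wakes at the midpoints of the L dyadic intervals around t. Any two distinct times share
such a midpoint separating them (`exists_common_mid`), and the start of a phase, where all are
awake, covers earlier phases. So competing nodes are never misinformed (`dominatedAt_iff`), and the
distributed run equals the idealised process (`joinedSet_succ`, `run_phases`), at L + 2 = O(log log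
N) awake rounds per phase.

The lemma uses one phase with D = ⌊Δ^0.7⌋. The corollary uses O(log log Δ) phases, each taking
roughly the square root of the excess of the degree bound over 128T. -/

namespace SampledLuby

open Finset
open scoped BigOperators

/-! ### Averages over independent uniform inputs, and supermartingales -/

section Expectation

variable {V X σ : Type}

/-- Coordinates of a uniformly random function are independent. -/
theorem expect_prod_apply [Fintype V] [DecidableEq V] [Fintype X] [Nonempty X]
    (B : Finset V) (g : X → ℝ) :
    (𝔼 x : V → X, ∏ i ∈ B, g (x i)) = (𝔼 a, g a) ^ B.card := by
  have h1 : ∀ x : V → X, ∏ i ∈ B, g (x i) = ∏ i, (if i ∈ B then g (x i) else 1) := by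
    intro x
    rw [Finset.prod_ite_mem, Finset.univ_inter]
  simp_rw [h1]
  have h2 := Finset.prod_univ_sum (fun _ : V => (Finset.univ : Finset X))
    (fun i a => if i ∈ B then g a else (1 : ℝ))
  rw [Fintype.piFinset_univ] at h2
  rw [Fintype.expect_eq_sum_div_card, ← h2, Fintype.expect_eq_sum_div_card]
  have h3 : ∀ i : V, ∑ a : X, (if i ∈ B then g a else (1 : ℝ)) =
      (Fintype.card X : ℝ) * (if i ∈ B then (∑ a, g a) / Fintype.card X else 1) := by
    intro i
    have : (Fintype.card X : ℝ) ≠ 0 := by exact_mod_cast Fintype.card_ne_zero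
    split_ifs
    · field_simp
    · simp
  simp_rw [h3]
  rw [Finset.prod_mul_distrib, Finset.prod_ite_mem, Finset.univ_inter, Finset.prod_const,
    Finset.prod_const, Fintype.card_fun, Finset.card_univ]
  have : (Fintype.card X : ℝ) ≠ 0 := by exact_mod_cast Fintype.card_ne_zero
  push_cast
  field_simp

/-- A process driven by the random inputs `x 0, x 1, …`. -/
def run (f : ℕ → σ → X → σ) (s : σ) : (n : ℕ) → (Fin n → X) → σ
  | 0, _ => s
  | n + 1, x => f n (run f s n (Fin.init x)) (x (Fin.last n))

theorem run_inv {f : ℕ → σ → X → σ} {s : σ} {Inv : σ → Prop} (h0 : Inv s)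
    (hf : ∀ k s x, Inv s → Inv (f k s x)) : ∀ (n : ℕ) (x : Fin n → X), Inv (run f s n x)
  | 0, _ => h0
  | n + 1, _ => hf _ _ _ (run_inv h0 hf n _)

theorem expect_snoc [Fintype X] (n : ℕ) (F : (Fin n → X) → X → ℝ) :
    (𝔼 x : Fin (n + 1) → X, F (Fin.init x) (x (Fin.last n))) = 𝔼 y, 𝔼 a, F y a := by
  have := Finset.expect_product (Finset.univ : Finset X) (Finset.univ : Finset (Fin n → X))
    (fun p : X × (Fin n → X) => F p.2 p.1)
  rw [Finset.expect_comm, ← this, Finset.univ_product_univ]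
  refine Fintype.expect_equiv (Fin.snocEquiv (fun _ => X)).symm _ _ ?_
  intro x
  rfl

/-- A supermartingale does not increase in expectation. -/
theorem expect_run_le [Fintype X] [Nonempty X] (f : ℕ → σ → X → σ) (s : σ) (Ψ : ℕ → σ → ℝ)
    (Inv : σ → Prop) (h0 : Inv s) (hf : ∀ k s x, Inv s → Inv (f k s x))
    (n : ℕ) (h : ∀ k < n, ∀ s, Inv s → (𝔼 x, Ψ (k + 1) (f k s x)) ≤ Ψ k s) :
    (𝔼 x : Fin n → X, Ψ n (run f s n x)) ≤ Ψ 0 s := by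
  induction n with
  | zero => simp [run]
  | succ n ih =>
    have := expect_snoc n (fun y (a : X) => Ψ (n + 1) (f n (run f s n y) a))
    simp only [run]
    rw [this]
    refine le_trans (Finset.expect_le_expect fun y _ => h n (Nat.lt_succ_self n) _
      (run_inv h0 hf n y)) (ih fun k hk => h k (Nat.lt_succ_of_lt hk))

end Expectation

/-! ### The probability of a unique small value -/

section TopCoin

variable {V : Type} [Fintype V]

open Classical in
theorem expect_lt {M J : ℕ} [NeZero M] (hJ : J ≤ M) :
    (𝔼 a : Fin M, if (a : ℕ) < J then (1 : ℝ) else 0) = J / M := by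
  rw [Fintype.expect_eq_sum_div_card, Fintype.card_fin, Finset.sum_boole]
  congr 2
  exact_mod_cast (Fin.card_filter_val_lt (n := M) (m := J)).trans (min_eq_right hJ)

open Classical in
/-- The probability that `u` draws a value below `J`, and nobody in `A` does. -/
theorem expect_unique_top {M J : ℕ} [NeZero M] (hJ : J ≤ M) (u : V) (A : Finset V) (huA : u ∉ A) :
    (J / M : ℝ) * (1 - A.card * (J / M)) ≤
      𝔼 x : V → Fin M, if (x u : ℕ) < J ∧ ∀ w ∈ A, J ≤ (x w : ℕ) then (1 : ℝ) else 0 := by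
  let g : Fin M → ℝ := fun a => if (a : ℕ) < J then (1 : ℝ) else 0
  have hg : (𝔼 a, g a) = J / M := expect_lt hJ
  have hu : (𝔼 x : V → Fin M, g (x u)) = J / M := by
    have := expect_prod_apply ({u} : Finset V) g
    simpa [hg] using this
  have huw : ∀ w ∈ A, (𝔼 x : V → Fin M, g (x u) * g (x w)) = (J / M : ℝ) ^ 2 := by
    intro w hw
    have hne : u ≠ w := fun h => huA (h ▸ hw)
    have := expect_prod_apply ({u, w} : Finset V) g
    rw [hg, Finset.card_pair hne] at this
    rw [← this]
    exact Finset.expect_congr rfl fun x _ => (Finset.prod_pair (f := fun i => g (x i)) hne).symm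
  -- Bonferroni: discarding every coincidence of `u` with some `w` undercounts the event, and needs
  -- only pairwise independence.
  have key : ∀ x : V → Fin M, g (x u) - ∑ w ∈ A, g (x u) * g (x w) ≤
      if (x u : ℕ) < J ∧ ∀ w ∈ A, J ≤ (x w : ℕ) then (1 : ℝ) else 0 := by
    intro x
    have hnn : ∀ a, 0 ≤ g a := fun a => by simp only [g]; split_ifs <;> norm_num
    have hsum : 0 ≤ ∑ w ∈ A, g (x u) * g (x w) :=
      Finset.sum_nonneg fun w _ => mul_nonneg (hnn _) (hnn _)
    by_cases h1 : (x u : ℕ) < J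
    · by_cases h2 : ∀ w ∈ A, J ≤ (x w : ℕ)
      · rw [if_pos ⟨h1, h2⟩]
        have : g (x u) = 1 := if_pos h1
        linarith
      · rw [if_neg (fun h => h2 h.2)]
        push Not at h2
        obtain ⟨w, hw, hlt⟩ := h2
        have h3 : g (x u) * g (x w) ≤ ∑ w ∈ A, g (x u) * g (x w) :=
          Finset.single_le_sum (f := fun w => g (x u) * g (x w))
            (fun w _ => mul_nonneg (hnn _) (hnn _)) hw
        have : g (x w) = 1 := if_pos hlt
        rw [this] at h3
        linarith
    · have : g (x u) = 0 := if_neg h1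
      rw [if_neg (fun h => h1 h.1)]
      linarith
  calc (J / M : ℝ) * (1 - A.card * (J / M))
      = 𝔼 x : V → Fin M, (g (x u) - ∑ w ∈ A, g (x u) * g (x w)) := by
        rw [Finset.expect_sub_distrib, hu, Finset.expect_sum_comm, Finset.sum_congr rfl huw,
          Finset.sum_const]
        simp only [nsmul_eq_mul]
        ring
    _ ≤ _ := Finset.expect_le_expect fun x _ => key x

end TopCoin

end SampledLuby

namespace SampledLuby

open Finset
open scoped BigOperators

/-! ### One sampled Luby step shrinks the degree sum -/

section OneStep

variable {V : Type}

/-- The nodes that join in one step with values `x` and threshold `m`, when `S` has joined before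
and the nodes in `U` do not compete any more. -/
def joins (G : SimpleGraph V) (m : ℕ) (S U : Set V) (x : V → ℕ) : Set V :=
  {v | v ∈ remainingNodes G S ∧ v ∉ U ∧ x v < m ∧
    ∀ w, G.Adj v w → w ∈ remainingNodes G S → w ∉ U → x v < x w}

/-- One step: the new joined set, and the new set of used nodes. -/
def lubyStep (G : SimpleGraph V) (m : ℕ) (s : Set V × Set V) (x : V → ℕ) : Set V × Set V :=
  (s.1 ∪ joins G m s.1 s.2 x, s.2 ∪ {v | x v < m})

theorem remainingNodes_anti (G : SimpleGraph V) {S S' : Set V} (h : S ⊆ S') :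
    remainingNodes G S' ⊆ remainingNodes G S :=
  fun _ hv => ⟨fun h' => hv.1 (h h'), fun u hu => hv.2 u (h hu)⟩

variable [Fintype V]

open Classical in
/-- The remaining nodes as a finite set. -/
noncomputable def rem (G : SimpleGraph V) (S : Set V) : Finset V :=
  univ.filter fun v => v ∈ remainingNodes G S

open Classical in
/-- The remaining neighbours of `v`. -/
noncomputable def nbrs (G : SimpleGraph V) (S : Set V) (v : V) : Finset V :=
  univ.filter fun u => G.Adj v u ∧ u ∈ remainingNodes G S

open Classical in
/-- The number of edges seen from remaining nodes of degree at least `D`. -/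
noncomputable def highDegreeSum (G : SimpleGraph V) (D : ℕ) (S : Set V) : ℝ :=
  ∑ v ∈ (rem G S).filter (fun v => D ≤ (nbrs G S v).card), ((nbrs G S v).card : ℝ)

theorem mem_rem {G : SimpleGraph V} {S : Set V} {v : V} :
    v ∈ rem G S ↔ v ∈ remainingNodes G S := by simp [rem]

theorem mem_nbrs {G : SimpleGraph V} {S : Set V} {v u : V} :
    u ∈ nbrs G S v ↔ G.Adj v u ∧ u ∈ remainingNodes G S := by simp [nbrs]

theorem nbrs_anti (G : SimpleGraph V) {S S' : Set V} (h : S ⊆ S') (v : V) :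
    nbrs G S' v ⊆ nbrs G S v := fun u hu => by
  rw [mem_nbrs] at hu ⊢
  exact ⟨hu.1, remainingNodes_anti G h hu.2⟩

/-- Luby's edge counting, restricted to nodes of high degree. -/
theorem sum_degree_ratio (G : SimpleGraph V) (D : ℕ) (hD : 1 ≤ D) (S : Set V) :
    highDegreeSum G D S / 2 ≤
      ∑ v ∈ (rem G S).filter (fun v => D ≤ (nbrs G S v).card), ∑ u ∈ nbrs G S v,
        ((nbrs G S v).card : ℝ) / ((nbrs G S u).card + (nbrs G S v).card) := by
  classical
  set H := (rem G S).filter (fun v => D ≤ (nbrs G S v).card) with hH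
  let d : V → ℝ := fun v => (nbrs G S v).card
  -- This weight is antisymmetric, so edges inside `H` cancel. An edge leaving `H` ends at a node of
  -- smaller degree and contributes a nonnegative amount.
  let w : V → V → ℝ := fun v u => d v / (d u + d v) - 1 / 2
  have hdpos : ∀ v ∈ H, 0 < d v := fun v hv => by
    have := (Finset.mem_filter.1 hv).2
    simp only [d]
    exact_mod_cast lt_of_lt_of_le hD this
  have hd0 : ∀ v, 0 ≤ d v := fun v => Nat.cast_nonneg _
  have anti : ∀ v ∈ H, ∀ u ∈ H, w v u = - w u v := by
    intro v hv u hu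
    have h1 := hdpos v hv
    have h2 := hdpos u hu
    simp only [w]
    field_simp
    ring
  have hz : ∑ v ∈ H, ∑ u ∈ H, (if G.Adj v u then w v u else 0) = 0 := by
    have h1 : ∑ v ∈ H, ∑ u ∈ H, (if G.Adj v u then w v u else 0) =
        - ∑ v ∈ H, ∑ u ∈ H, (if G.Adj v u then w v u else 0) := by
      conv_lhs => rw [Finset.sum_comm]
      rw [← Finset.sum_neg_distrib]
      refine Finset.sum_congr rfl fun v hv => ?_
      rw [← Finset.sum_neg_distrib]
      refine Finset.sum_congr rfl fun u hu => ?_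
      by_cases h : G.Adj v u
      · rw [if_pos h, if_pos h.symm, anti u hu v hv]
      · rw [if_neg h, if_neg (fun h' => h h'.symm), neg_zero]
    linarith
  have hle : ∑ v ∈ H, ∑ u ∈ H, (if G.Adj v u then w v u else 0) ≤
      ∑ v ∈ H, ∑ u ∈ nbrs G S v, w v u := by
    refine Finset.sum_le_sum fun v hv => ?_
    rw [← Finset.sum_filter]
    refine Finset.sum_le_sum_of_subset_of_nonneg ?_ ?_
    · intro u hu
      rw [Finset.mem_filter, hH, Finset.mem_filter, mem_rem] at hu
      exact mem_nbrs.2 ⟨hu.2, hu.1.1⟩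
    · intro u hu hnu
      rw [mem_nbrs] at hu
      have hlow : (nbrs G S u).card < D := by
        by_contra hcon
        exact hnu (Finset.mem_filter.2 ⟨Finset.mem_filter.2 ⟨mem_rem.2 hu.2, not_lt.1 hcon⟩, hu.1⟩)
      have : d u ≤ d v := by
        simp only [d]
        exact_mod_cast hlow.le.trans (Finset.mem_filter.1 hv).2
      have hv0 := hdpos v hv
      have hu0 := hd0 u
      simp only [w]
      rw [sub_nonneg, div_le_div_iff₀ (by norm_num) (by linarith)]
      linarith
  rw [hz] at hle
  have hsplit : ∑ v ∈ H, ∑ u ∈ nbrs G S v, w v u =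
      ∑ v ∈ H, ∑ u ∈ nbrs G S v, d v / (d u + d v) - highDegreeSum G D S / 2 := by
    simp only [w, Finset.sum_sub_distrib, Finset.sum_const, nsmul_eq_mul]
    rw [highDegreeSum, Finset.sum_div]
    congr 1
    refine Finset.sum_congr (by rw [hH]) fun v _ => by ring
  rw [hsplit] at hle
  simp only [d] at hle
  linarith

open Classical in
/-- The probability that a neighbour `u` joins while beating all neighbours of `v` as well. -/
theorem expect_win {M N a J : ℕ} [NeZero M] (hM : 4 * N ≤ M) (ha : 1 ≤ a) (haN : a ≤ 2 * N)
    (hJ : J = M / (2 * a)) (u : V) (A : Finset V) (huA : u ∉ A) (hA : A.card ≤ a) :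
    1 / (8 * a : ℝ) ≤
      𝔼 x : V → Fin M, if (x u : ℕ) < J ∧ ∀ w ∈ A, J ≤ (x w : ℕ) then (1 : ℝ) else 0 := by
  have hJM : J ≤ M := hJ ▸ Nat.div_le_self _ _
  refine le_trans ?_ (expect_unique_top hJM u A huA)
  have hM0 : (0 : ℝ) < M := by exact_mod_cast Nat.pos_of_ne_zero (NeZero.ne M)
  have ha0 : (0 : ℝ) < a := by exact_mod_cast ha
  have hJle : 2 * a * J ≤ M := hJ ▸ Nat.mul_div_le _ _
  -- Since `2 * a ≤ 4 * N ≤ M`, the quotient is at least 1, so rounding down loses at most a factor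
  -- 2.
  have hJge : M ≤ 4 * a * J := by
    have h1 : 1 ≤ J := by
      rw [hJ]; exact (Nat.one_le_div_iff (by omega)).2 (by omega)
    have h2 : M < 2 * a * (J + 1) := by
      rw [hJ]; exact Nat.lt_mul_div_succ _ (by omega)
    nlinarith
  have hJle' : (2 * a * J : ℝ) ≤ M := by exact_mod_cast hJle
  have hJge' : (M : ℝ) ≤ 4 * a * J := by exact_mod_cast hJge
  have hA' : (A.card : ℝ) ≤ a := by exact_mod_cast hA
  have hβ1 : (1 : ℝ) / (4 * a) ≤ J / M := by
    rw [div_le_div_iff₀ (by positivity) hM0]; linarith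
  have hβ2 : (A.card : ℝ) * (J / M) ≤ 1 / 2 := by
    calc (A.card : ℝ) * (J / M) ≤ a * (J / M) := by gcongr
      _ ≤ 1 / 2 := by
        rw [← mul_div_assoc, div_le_div_iff₀ hM0 (by norm_num)]; linarith
  calc 1 / (8 * a : ℝ) = 1 / (4 * a) * (1 - 1 / 2) := by field_simp; norm_num
    _ ≤ _ := by
      apply mul_le_mul hβ1 (by linarith) (by norm_num) (by positivity)

open Classical in
/-- Expected decrease of the degree sum in one step, when few neighbours are used. -/
theorem expect_highDegreeSum_step {M N D : ℕ} [NeZero M] (G : SimpleGraph V)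
    (hN : Fintype.card V ≤ N) (hM : 4 * N ≤ M) (hD : 1 ≤ D) (S U : Set V)
    (hU : ∀ v ∈ remainingNodes G S, 4 * ((nbrs G S v).filter (fun u => u ∈ U)).card ≤ D) :
    (𝔼 x : V → Fin M, highDegreeSum G D
        (lubyStep G (M / D) (S, U) (fun v => (x v : ℕ))).1) ≤
      31 / 32 * highDegreeSum G D S := by
  set H := (rem G S).filter (fun v => D ≤ (nbrs G S v).card) with hH
  let d : V → ℕ := fun v => (nbrs G S v).card
  let act : V → Finset V := fun v => (nbrs G S v).filter (fun u => u ∉ U)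
  -- Beating the active neighbours of `u` makes `u` join. Beating those of `v` as well makes the
  -- winning events for different `u` disjoint, so that their probabilities add up.
  let A : V → V → Finset V := fun v u => ((act u ∪ act v).erase u)
  let J : V → V → ℕ := fun v u => M / (2 * (d u + d v))
  let win : V → V → (V → Fin M) → Prop := fun v u x =>
    (x u : ℕ) < J v u ∧ ∀ w ∈ A v u, J v u ≤ (x w : ℕ)
  have hdD : ∀ v ∈ H, D ≤ d v := fun v hv => (Finset.mem_filter.1 hv).2
  have hdN : ∀ v, d v ≤ N := fun v => (Finset.card_le_univ _).trans hN
  -- winning neighbours remove `v`, and at most one neighbour wins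
  have hrem : ∀ v ∈ H, ∀ x : V → Fin M,
      (if v ∈ rem G (lubyStep G (M / D) (S, U) (fun v => (x v : ℕ))).1 then (1 : ℝ) else 0) ≤
        1 - ∑ u ∈ act v, if win v u x then (1 : ℝ) else 0 := by
    intro v hv x
    by_cases hw : ∃ u ∈ act v, win v u x
    · obtain ⟨u, hu, hwin⟩ := hw
      have huS := Finset.mem_filter.1 hu
      have huv := mem_nbrs.1 huS.1
      have hjoin : u ∈ joins G (M / D) S U (fun v => (x v : ℕ)) := by
        refine ⟨huv.2, huS.2, lt_of_lt_of_le hwin.1 ?_, ?_⟩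
        · exact Nat.div_le_div_left (by have := hdD v hv; omega) (by omega)
        · intro w hadj hwR hwU
          refine lt_of_lt_of_le hwin.1 (hwin.2 w ?_)
          refine Finset.mem_erase.2 ⟨hadj.ne', Finset.mem_union_left _ ?_⟩
          exact Finset.mem_filter.2 ⟨mem_nbrs.2 ⟨hadj, hwR⟩, hwU⟩
      have hnot : v ∉ rem G (lubyStep G (M / D) (S, U) (fun v => (x v : ℕ))).1 := by
        rw [mem_rem]
        intro h
        exact h.2 u (Or.inr hjoin) huv.1
      rw [if_neg hnot]
      have hone : ∑ u' ∈ act v, (if win v u' x then (1 : ℝ) else 0) = 1 := by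
        rw [Finset.sum_eq_single_of_mem u hu, if_pos hwin]
        intro u' hu' hne
        rw [if_neg]
        intro hwin'
        have h1 := hwin.2 u' (Finset.mem_erase.2 ⟨hne, Finset.mem_union_right _ hu'⟩)
        have h2 := hwin'.2 u (Finset.mem_erase.2 ⟨hne.symm, Finset.mem_union_right _ hu⟩)
        have h3 := hwin.1
        have h4 := hwin'.1
        omega
      rw [hone]; norm_num
    · have hz : ∑ u ∈ act v, (if win v u x then (1 : ℝ) else 0) = 0 := by
        refine Finset.sum_eq_zero fun u hu => if_neg fun h => hw ⟨u, hu, h⟩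
      rw [hz]
      split_ifs <;> norm_num
  have hpoint : ∀ x : V → Fin M, highDegreeSum G D
      (lubyStep G (M / D) (S, U) (fun v => (x v : ℕ))).1 ≤
        ∑ v ∈ H, (d v : ℝ) * (1 - ∑ u ∈ act v, if win v u x then (1 : ℝ) else 0) := by
    intro x
    set S' := (lubyStep G (M / D) (S, U) (fun v => (x v : ℕ))).1 with hS'
    have hSS : S ⊆ S' := Set.subset_union_left
    have hcard : ∀ v, (nbrs G S' v).card ≤ d v := fun v => Finset.card_le_card (nbrs_anti G hSS v)
    calc highDegreeSum G D S'
        ≤ ∑ v ∈ (rem G S').filter (fun v => D ≤ (nbrs G S' v).card), (d v : ℝ) :=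
          Finset.sum_le_sum fun v _ => by exact_mod_cast hcard v
      _ ≤ ∑ v ∈ H.filter (fun v => v ∈ rem G S'), (d v : ℝ) := by
          refine Finset.sum_le_sum_of_subset_of_nonneg ?_ fun _ _ _ => Nat.cast_nonneg _
          intro v hv
          rw [Finset.mem_filter] at hv
          rw [Finset.mem_filter, hH, Finset.mem_filter]
          exact ⟨⟨mem_rem.2 (remainingNodes_anti G hSS (mem_rem.1 hv.1)),
            hv.2.trans (hcard v)⟩, hv.1⟩
      _ = ∑ v ∈ H, (d v : ℝ) * (if v ∈ rem G S' then (1 : ℝ) else 0) := by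
          rw [Finset.sum_filter]
          exact Finset.sum_congr rfl fun v _ => by split_ifs <;> simp
      _ ≤ _ := Finset.sum_le_sum fun v hv =>
          mul_le_mul_of_nonneg_left (hrem v hv x) (Nat.cast_nonneg _)
  have hprob : ∀ v ∈ H, ∀ u ∈ act v, 1 / (8 * ((d u : ℝ) + d v)) ≤
      𝔼 x : V → Fin M, if win v u x then (1 : ℝ) else 0 := by
    intro v hv u hu
    have h1 := hdD v hv
    have h2 := hdN v
    have h3 := hdN u
    have := expect_win (M := M) (N := N) (a := d u + d v) (J := J v u) hM (by omega) (by omega) rfl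
      u (A v u) (Finset.notMem_erase _ _) ?_
    · push_cast at this
      exact this
    · refine (Finset.card_le_card (Finset.erase_subset _ _)).trans
        ((Finset.card_union_le _ _).trans ?_)
      exact add_le_add (Finset.card_filter_le _ _) (Finset.card_filter_le _ _)
  have hexp : (𝔼 x : V → Fin M, highDegreeSum G D
      (lubyStep G (M / D) (S, U) (fun v => (x v : ℕ))).1) ≤
        ∑ v ∈ H, (d v : ℝ) * (1 - ∑ u ∈ act v, 1 / (8 * ((d u : ℝ) + d v))) := by
    refine (Finset.expect_le_expect fun x _ => hpoint x).trans ?_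
    rw [Finset.expect_sum_comm]
    refine Finset.sum_le_sum fun v hv => ?_
    rw [← Finset.mul_expect, Finset.expect_sub_distrib, Finset.expect_sum_comm,
      Finset.expect_const Finset.univ_nonempty]
    refine mul_le_mul_of_nonneg_left ?_ (Nat.cast_nonneg _)
    exact sub_le_sub_left (Finset.sum_le_sum fun u hu => hprob v hv u hu) _
  have hratio := sum_degree_ratio G D hD S
  have hused : ∀ v ∈ H, ∑ u ∈ nbrs G S v, (d v : ℝ) / (d u + d v) ≤
      (∑ u ∈ act v, (d v : ℝ) / (d u + d v)) + d v / 4 := by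
    intro v hv
    have hsplit := Finset.sum_filter_add_sum_filter_not (nbrs G S v) (fun u => u ∉ U)
      (fun u => (d v : ℝ) / (d u + d v))
    rw [← hsplit]
    refine add_le_add le_rfl ?_
    simp only [not_not]
    have h1 := hU v (mem_rem.1 (Finset.mem_filter.1 hv).1)
    have h2 := hdD v hv
    calc ∑ u ∈ (nbrs G S v).filter (fun u => u ∈ U), (d v : ℝ) / (d u + d v)
        ≤ ∑ u ∈ (nbrs G S v).filter (fun u => u ∈ U), (1 : ℝ) := by
          refine Finset.sum_le_sum fun u _ => div_le_one_of_le₀ ?_ ?_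
          · have : (0 : ℝ) ≤ d u := Nat.cast_nonneg _
            linarith
          · positivity
      _ = ((nbrs G S v).filter (fun u => u ∈ U)).card := by simp
      _ ≤ (d v : ℝ) / 4 := by
          have : (4 * ((nbrs G S v).filter (fun u => u ∈ U)).card : ℝ) ≤ d v := by
            exact_mod_cast h1.trans h2
          linarith
  have hsum : highDegreeSum G D S / 2 ≤
      (∑ v ∈ H, ∑ u ∈ act v, (d v : ℝ) / (d u + d v)) + highDegreeSum G D S / 4 := by
    refine hratio.trans ((Finset.sum_le_sum hused).trans_eq ?_)
    rw [Finset.sum_add_distrib, ← Finset.sum_div]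
    rfl
  have hfinal : ∑ v ∈ H, (d v : ℝ) * (1 - ∑ u ∈ act v, 1 / (8 * ((d u : ℝ) + d v))) =
      highDegreeSum G D S - (∑ v ∈ H, ∑ u ∈ act v, (d v : ℝ) / (d u + d v)) / 8 := by
    have hr : highDegreeSum G D S = ∑ v ∈ H, (d v : ℝ) := rfl
    rw [hr, Finset.sum_div, ← Finset.sum_sub_distrib]
    refine Finset.sum_congr rfl fun v hv => ?_
    rw [mul_sub, mul_one, Finset.mul_sum, Finset.sum_div]
    congr 1
    refine Finset.sum_congr rfl fun u _ => ?_
    rw [mul_one_div, div_div, mul_comm (8 : ℝ)]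
  -- The loss 1/32 is (1/2 - 1/4)/8: half from edge counting, a quarter given up to used neighbours,
  -- and 1/8 from the winning probability.
  rw [hfinal] at hexp
  linarith

open Classical in
/-- The expected exponential moment of the number of values below a threshold. -/
theorem expect_pow_card {M m : ℕ} [NeZero M] (hm : m ≤ M) (B : Finset V) :
    (𝔼 x : V → Fin M, (16 : ℝ) ^ (B.filter (fun u => (x u : ℕ) < m)).card) =
      (1 + 15 * (m / M : ℝ)) ^ B.card := by
  let g : Fin M → ℝ := fun a => if (a : ℕ) < m then (16 : ℝ) else 1
  have hg : (𝔼 a, g a) = 1 + 15 * (m / M : ℝ) := by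
    have : ∀ a : Fin M, g a = 1 + 15 * (if (a : ℕ) < m then (1 : ℝ) else 0) := by
      intro a; simp only [g]; split_ifs <;> norm_num
    simp_rw [this]
    rw [Finset.expect_add_distrib, ← Finset.mul_expect, expect_lt hm,
      Finset.expect_const Finset.univ_nonempty]
  rw [← hg, ← expect_prod_apply B g]
  refine Finset.expect_congr rfl fun x _ => ?_
  simp only [g]
  rw [Finset.prod_ite, Finset.prod_const, Finset.prod_const_one, mul_one]

end OneStep

end SampledLuby

namespace SampledLuby

open Finset
open scoped BigOperators

/-! ### Failure probability of one phase and of a sequence of phases -/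

section Phase

variable {V : Type} [Fintype V]

theorem highDegreeSum_le (G : SimpleGraph V) (D : ℕ) (S : Set V) {N : ℕ}
    (hN : Fintype.card V ≤ N) : highDegreeSum G D S ≤ (N : ℝ) ^ 2 := by
  classical
  have hN' : (Fintype.card V : ℝ) ≤ N := by exact_mod_cast hN
  calc highDegreeSum G D S
      ≤ ∑ v ∈ (rem G S).filter (fun v => D ≤ (nbrs G S v).card), (N : ℝ) :=
        Finset.sum_le_sum fun v _ => by exact_mod_cast (Finset.card_le_univ _).trans hN
    _ = (((rem G S).filter (fun v => D ≤ (nbrs G S v).card)).card : ℝ) * N := by simp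
    _ ≤ N * N := by
        gcongr
        exact (Finset.card_le_univ _).trans hN
    _ = (N : ℝ) ^ 2 := by ring

theorem highDegreeSum_nonneg (G : SimpleGraph V) (D : ℕ) (S : Set V) :
    0 ≤ highDegreeSum G D S := Finset.sum_nonneg fun _ _ => Nat.cast_nonneg _

theorem one_le_highDegreeSum (G : SimpleGraph V) {D : ℕ} (hD : 1 ≤ D) {S : Set V} {v : V}
    (hv : v ∈ remainingNodes G S) (hdeg : D ≤ (nbrs G S v).card) : 1 ≤ highDegreeSum G D S := by
  classical
  have h1 : (1 : ℝ) ≤ (nbrs G S v).card := by exact_mod_cast hD.trans hdeg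
  exact h1.trans (Finset.single_le_sum (f := fun v => ((nbrs G S v).card : ℝ))
    (fun _ _ => Nat.cast_nonneg _) (Finset.mem_filter.2 ⟨mem_rem.2 hv, hdeg⟩))

/-- The moment is at most e^(15TΔ/D) ≤ e^(15D/64) ≤ (3/2)^D, the last because (3/2)^4 > e. Dividing
by 2^D, as in Markov's inequality, leaves (3/4)^D. -/
theorem exp_pow_div_two_pow_le {Δ D T : ℕ} (hD : 1 ≤ D) (hTD : T ≤ D)
    (hΔ : 64 * T * Δ ≤ D ^ 2) {p : ℝ} (hp0 : 0 ≤ p) (hp : p ≤ 1 / D) :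
    ((1 + 15 * p) ^ Δ) ^ T / 2 ^ D ≤ (31 / 32 : ℝ) ^ T := by
  have hD0 : (0 : ℝ) < D := by exact_mod_cast hD
  have h1 : ((1 + 15 * p) ^ Δ) ^ T ≤ (3 / 2 : ℝ) ^ D := by
    have hp' : 1 + 15 * p ≤ Real.exp (15 / D) := by
      have h2 := Real.add_one_le_exp (15 / D : ℝ)
      have h3 : 15 * p ≤ 15 / D := by
        rw [div_eq_mul_one_div]; linarith
      linarith
    have hexp : Real.exp (15 / 64) ≤ 3 / 2 := by
      have h4 : Real.exp (15 / 64) ^ 4 = Real.exp (15 / 16) := by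
        rw [← Real.exp_nat_mul]; norm_num
      have h5 : Real.exp (15 / 16) ≤ Real.exp 1 := Real.exp_le_exp.2 (by norm_num)
      have h6 := Real.exp_one_lt_d9
      by_contra hcon
      push Not at hcon
      have h7 : (3 / 2 : ℝ) ^ 4 < Real.exp (15 / 64) ^ 4 :=
        pow_lt_pow_left₀ hcon (by norm_num) (by norm_num)
      rw [h4] at h7
      norm_num at h7
      linarith
    have hcast : (64 * T * Δ : ℝ) ≤ (D : ℝ) ^ 2 := by exact_mod_cast hΔ
    calc ((1 + 15 * p) ^ Δ) ^ T ≤ (Real.exp (15 / D) ^ Δ) ^ T := by gcongr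
      _ = Real.exp (((Δ * T : ℕ) : ℝ) * (15 / D)) := by
          rw [← pow_mul, ← Real.exp_nat_mul]
      _ ≤ Real.exp ((D : ℝ) * (15 / 64)) := by
          refine Real.exp_le_exp.2 ?_
          rw [← mul_div_assoc, div_le_iff₀ hD0]
          push_cast
          nlinarith
      _ = Real.exp (15 / 64) ^ D := by rw [Real.exp_nat_mul]
      _ ≤ (3 / 2 : ℝ) ^ D := by gcongr
  calc ((1 + 15 * p) ^ Δ) ^ T / 2 ^ D ≤ (3 / 2 : ℝ) ^ D / 2 ^ D := by gcongr
    _ = (3 / 4 : ℝ) ^ D := by rw [← div_pow]; norm_num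
    _ ≤ (3 / 4 : ℝ) ^ T := pow_le_pow_of_le_one (by norm_num) (by norm_num) hTD
    _ ≤ (31 / 32 : ℝ) ^ T := pow_le_pow_left₀ (by norm_num) (by norm_num) _

/-- The steps of one phase, driven by uniform values in `Fin M`. -/
def phaseStep (G : SimpleGraph V) (m M : ℕ) (_ : ℕ) (s : Set V × Set V) (x : V → Fin M) :
    Set V × Set V :=
  lubyStep G m s (fun v => (x v : ℕ))

open Classical in
/-- One phase reduces the maximum degree below `D`, except with small probability. -/
theorem expect_phase_failure {M N Δ D T : ℕ} [NeZero M] (G : SimpleGraph V)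
    (hN : Fintype.card V ≤ N) (hM : 4 * N ≤ M) (hD : 1 ≤ D) (hTD : T ≤ D)
    (hΔ : 64 * T * Δ ≤ D ^ 2) (S₀ : Set V)
    (hdeg : ∀ v ∈ remainingNodes G S₀, (nbrs G S₀ v).card ≤ Δ) :
    (𝔼 y : Fin T → V → Fin M,
      if ∃ v ∈ remainingNodes G (run (phaseStep G (M / D) M) (S₀, ∅) T y).1,
        D ≤ (nbrs G (run (phaseStep G (M / D) M) (S₀, ∅) T y).1 v).card then (1 : ℝ) else 0) ≤
      2 * (N : ℝ) ^ 2 * (31 / 32) ^ T := by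
  set f := phaseStep G (M / D) M with hf
  let used : Set V × Set V → V → ℕ := fun s v => ((nbrs G S₀ v).filter (fun u => u ∈ s.2)).card
  let good : Set V × Set V → Prop := fun s => ∀ v ∈ rem G S₀, 4 * used s v ≤ D
  -- Used sets only grow, so a state that is not good never becomes good again. Setting the
  -- potential to 0 there keeps it a supermartingale without conditioning.
  let Φ : Set V × Set V → ℝ := fun s => if good s then highDegreeSum G D s.1 else 0
  let Ψ : Set V × Set V → ℝ := fun s => ∑ v ∈ rem G S₀, (16 : ℝ) ^ used s v
  have hM0 : (0 : ℝ) < M := by exact_mod_cast Nat.pos_of_ne_zero (NeZero.ne M)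
  have hD0 : (0 : ℝ) < D := by exact_mod_cast hD
  have hinv : ∀ (k : ℕ) (s : Set V × Set V) (x : V → Fin M), S₀ ⊆ s.1 → S₀ ⊆ (f k s x).1 :=
    fun k s x hs => hs.trans Set.subset_union_left
  have hΦ : (𝔼 y : Fin T → V → Fin M, Φ (run f (S₀, ∅) T y)) ≤ (N : ℝ) ^ 2 * (31 / 32) ^ T := by
    have h := expect_run_le f (S₀, ∅) (fun k s => (32 / 31 : ℝ) ^ k * Φ s) (fun s => S₀ ⊆ s.1)
      subset_rfl hinv T ?_
    · rw [← Finset.mul_expect] at h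
      have h0 : Φ (S₀, ∅) ≤ (N : ℝ) ^ 2 := by
        simp only [Φ]
        split_ifs
        · exact highDegreeSum_le G D S₀ hN
        · positivity
      have h1 : (31 / 32 : ℝ) ^ T * (32 / 31) ^ T = 1 := by rw [← mul_pow]; norm_num
      calc (𝔼 y : Fin T → V → Fin M, Φ (run f (S₀, ∅) T y))
          = (31 / 32 : ℝ) ^ T * ((32 / 31) ^ T *
            𝔼 y : Fin T → V → Fin M, Φ (run f (S₀, ∅) T y)) := by rw [← mul_assoc, h1, one_mul]
        _ ≤ (31 / 32 : ℝ) ^ T * (N : ℝ) ^ 2 := by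
            gcongr
            refine h.trans ?_
            simpa using h0
        _ = _ := mul_comm _ _
    · intro k _ s hs
      rw [← Finset.mul_expect, pow_succ, mul_assoc]
      refine mul_le_mul_of_nonneg_left ?_ (by positivity)
      by_cases hg : good s
      · have h1 := expect_highDegreeSum_step (M := M) (D := D) G hN hM hD s.1 s.2 ?_
        · have h2 : (𝔼 x : V → Fin M, Φ (f k s x)) ≤ 31 / 32 * Φ s := by
            refine (Finset.expect_le_expect fun x _ => ?_).trans (h1.trans_eq ?_)
            · simp only [Φ]
              split_ifs
              · exact le_rfl
              · exact highDegreeSum_nonneg _ _ _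
            · simp only [Φ, if_pos hg]
          linarith
        · intro v hv
          refine le_trans ?_ (hg v (mem_rem.2 (remainingNodes_anti G hs hv)))
          exact Nat.mul_le_mul_left _ (Finset.card_le_card
            (Finset.filter_subset_filter _ (nbrs_anti G hs v)))
      · have hz : ∀ x : V → Fin M, Φ (f k s x) = 0 := by
          intro x
          simp only [Φ]
          rw [if_neg]
          intro hg'
          refine hg fun v hv => le_trans ?_ (hg' v hv)
          refine Nat.mul_le_mul_left _ (Finset.card_le_card fun u hu => ?_)
          rw [Finset.mem_filter] at hu ⊢
          exact ⟨hu.1, Or.inl hu.2⟩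
        simp_rw [hz]
        simp [Φ, hg]
  set p : ℝ := ((M / D : ℕ) : ℝ) / M with hp
  have hp0 : 0 ≤ p := by positivity
  have hpD : p ≤ 1 / D := by
    rw [hp, div_le_div_iff₀ hM0 hD0]
    have := Nat.div_mul_le_self M D
    rw [one_mul]
    exact_mod_cast this
  set ρ : ℝ := (1 + 15 * p) ^ Δ with hρ
  have hρ0 : 0 < ρ := by positivity
  have hΨ : (𝔼 y : Fin T → V → Fin M, Ψ (run f (S₀, ∅) T y)) ≤ ρ ^ T * N := by
    have h := expect_run_le f (S₀, ∅) (fun k s => (ρ ^ k)⁻¹ * Ψ s) (fun _ => True)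
      trivial (fun _ _ _ _ => trivial) T ?_
    · rw [← Finset.mul_expect] at h
      have h0 : Ψ (S₀, ∅) ≤ N := by
        simp only [Ψ, used]
        simp only [Set.mem_empty_iff_false, Finset.filter_false, Finset.card_empty, pow_zero,
          Finset.sum_const, nsmul_eq_mul, mul_one]
        exact_mod_cast (Finset.card_le_univ _).trans hN
      rw [pow_zero, inv_one, one_mul, inv_mul_le_iff₀ (by positivity)] at h
      exact h.trans (by gcongr)
    · intro k _ s _
      rw [← Finset.mul_expect, pow_succ, mul_inv, mul_assoc]
      refine mul_le_mul_of_nonneg_left ?_ (by positivity)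
      rw [inv_mul_le_iff₀ hρ0]
      simp only [Ψ]
      rw [Finset.expect_sum_comm, Finset.mul_sum]
      refine Finset.sum_le_sum fun v hv => ?_
      have hle : ∀ x : V → Fin M, (16 : ℝ) ^ used (f k s x) v ≤ 16 ^ used s v *
          16 ^ ((nbrs G S₀ v).filter (fun u => (x u : ℕ) < M / D)).card := by
        intro x
        rw [← pow_add]
        refine pow_le_pow_right₀ (by norm_num) ?_
        refine (Finset.card_le_card ?_).trans (Finset.card_union_le _ _)
        intro u hu
        rw [Finset.mem_filter] at hu
        rcases hu.2 with h | h
        · exact Finset.mem_union_left _ (Finset.mem_filter.2 ⟨hu.1, h⟩)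
        · exact Finset.mem_union_right _ (Finset.mem_filter.2 ⟨hu.1, h⟩)
      refine (Finset.expect_le_expect fun x _ => hle x).trans ?_
      rw [← Finset.mul_expect, expect_pow_card (Nat.div_le_self M D), mul_comm]
      refine mul_le_mul_of_nonneg_right ?_ (by positivity)
      rw [hρ]
      exact pow_le_pow_right₀ (by linarith) (hdeg v (mem_rem.1 hv))
  -- A bad outcome either is good in the sense above, and then the degree sum is at least 1, or has
  -- a node with more than D/4 used neighbours, and then `Ψ` is at least 2^D. The base 16 = 2^4
  -- matches the fraction 1/4.
  have hpoint : ∀ y : Fin T → V → Fin M,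
      (if ∃ v ∈ remainingNodes G (run f (S₀, ∅) T y).1,
        D ≤ (nbrs G (run f (S₀, ∅) T y).1 v).card then (1 : ℝ) else 0) ≤
      Φ (run f (S₀, ∅) T y) + (2 ^ D : ℝ)⁻¹ * Ψ (run f (S₀, ∅) T y) := by
    intro y
    set s := run f (S₀, ∅) T y
    have hΨ0 : 0 ≤ Ψ s := Finset.sum_nonneg fun _ _ => by positivity
    have hΦ0 : 0 ≤ Φ s := by
      simp only [Φ]
      split_ifs
      · exact highDegreeSum_nonneg _ _ _
      · exact le_rfl
    have hΨ0' : 0 ≤ (2 ^ D : ℝ)⁻¹ * Ψ s := by positivity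
    split_ifs with hbad
    · by_cases hg : good s
      · obtain ⟨v, hv, hd⟩ := hbad
        have : Φ s = highDegreeSum G D s.1 := if_pos hg
        have := one_le_highDegreeSum G hD hv hd
        linarith
      · have hg' : ∃ v ∈ rem G S₀, D < 4 * used s v := by
          by_contra hcon
          push Not at hcon
          exact hg hcon
        obtain ⟨v, hv, hu⟩ := hg'
        have h1 : (2 : ℝ) ^ D ≤ Ψ s := by
          calc (2 : ℝ) ^ D ≤ 2 ^ (4 * used s v) := pow_le_pow_right₀ (by norm_num) hu.le
            _ = 16 ^ used s v := by rw [pow_mul]; norm_num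
            _ ≤ Ψ s := Finset.single_le_sum (f := fun v => (16 : ℝ) ^ used s v)
                (fun _ _ => by positivity) hv
        have h2 : 1 ≤ (2 ^ D : ℝ)⁻¹ * Ψ s := by
          rw [le_inv_mul_iff₀ (by positivity), mul_one]; exact h1
        linarith
    · linarith
  refine (Finset.expect_le_expect fun y _ => hpoint y).trans ?_
  rw [Finset.expect_add_distrib, ← Finset.mul_expect]
  have hratio := exp_pow_div_two_pow_le hD hTD hΔ hp0 hpD
  have hsecond : (2 ^ D : ℝ)⁻¹ * (𝔼 y : Fin T → V → Fin M, Ψ (run f (S₀, ∅) T y)) ≤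
      (N : ℝ) ^ 2 * (31 / 32) ^ T := by
    calc (2 ^ D : ℝ)⁻¹ * (𝔼 y : Fin T → V → Fin M, Ψ (run f (S₀, ∅) T y))
        ≤ (2 ^ D : ℝ)⁻¹ * (ρ ^ T * N) := by gcongr
      _ = N * (ρ ^ T / 2 ^ D) := by ring
      _ ≤ (N : ℝ) ^ 2 * (31 / 32) ^ T := by
        refine mul_le_mul ?_ hratio (by positivity) (by positivity)
        have : N ≤ N ^ 2 := Nat.le_self_pow (by norm_num) N
        exact_mod_cast this
  linarith

/-- The joined set after one phase, as a function of the joined set before. -/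
def phases (G : SimpleGraph V) (M T : ℕ) (D : ℕ → ℕ) (i : ℕ) (S : Set V)
    (y : Fin T → V → Fin M) : Set V :=
  (run (phaseStep G (M / D (i + 1)) M) (S, ∅) T y).1

open Classical in
/-- Failure probability of a sequence of phases with degree bounds `D 0, D 1, …`. -/
theorem expect_phases_failure {M N T P : ℕ} [NeZero M] (G : SimpleGraph V) (D : ℕ → ℕ)
    (hN : Fintype.card V ≤ N) (hM : 4 * N ≤ M) (hD : ∀ i < P, 1 ≤ D (i + 1))
    (hTD : ∀ i < P, T ≤ D (i + 1)) (hΔ : ∀ i < P, 64 * T * D i ≤ D (i + 1) ^ 2)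
    (h0 : ∀ v, (nbrs G ∅ v).card ≤ D 0) :
    (𝔼 y : Fin P → Fin T → V → Fin M,
      if ∃ v ∈ remainingNodes G (run (phases G M T D) ∅ P y),
        D P < (nbrs G (run (phases G M T D) ∅ P y) v).card then (1 : ℝ) else 0) ≤
      P * (2 * (N : ℝ) ^ 2 * (31 / 32) ^ T) := by
  set δ : ℝ := 2 * (N : ℝ) ^ 2 * (31 / 32) ^ T with hδ
  have hδ0 : 0 ≤ δ := by positivity
  let bad : ℕ → Set V → Prop := fun i S => ∃ v ∈ remainingNodes G S, D i < (nbrs G S v).card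
  -- Subtracting `k * δ` turns the union bound over phases into a supermartingale: from a bad state
  -- the indicator cannot exceed 1, from any other it rises by at most `δ` on average.
  have h := expect_run_le (phases G M T D) ∅
    (fun k S => (if bad k S then (1 : ℝ) else 0) - k * δ) (fun _ => True) trivial
    (fun _ _ _ _ => trivial) P ?_
  · rw [Finset.expect_sub_distrib, Finset.expect_const Finset.univ_nonempty] at h
    have hb : ¬ bad 0 ∅ := by
      rintro ⟨v, _, hv⟩
      exact absurd (h0 v) (not_le.2 hv)
    rw [if_neg hb] at h
    simp only [Nat.cast_zero, zero_mul, sub_zero] at h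
    exact sub_nonpos.1 h
  · intro k hk S _
    rw [Finset.expect_sub_distrib, Finset.expect_const Finset.univ_nonempty]
    push_cast
    by_cases hb : bad k S
    · rw [if_pos hb]
      have h1 : (𝔼 y : Fin T → V → Fin M,
          if bad (k + 1) (phases G M T D k S y) then (1 : ℝ) else 0) ≤
          𝔼 _y : Fin T → V → Fin M, (1 : ℝ) :=
        Finset.expect_le_expect fun y _ => by split_ifs <;> norm_num
      rw [Finset.expect_const Finset.univ_nonempty] at h1
      linarith
    · rw [if_neg hb]
      have hdeg : ∀ v ∈ remainingNodes G S, (nbrs G S v).card ≤ D k := by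
        intro v hv
        by_contra hcon
        exact hb ⟨v, hv, not_le.1 hcon⟩
      have h1 := expect_phase_failure G hN hM (hD k hk) (hTD k hk) (hΔ k hk) S hdeg
      have h2 : (𝔼 y : Fin T → V → Fin M,
          if bad (k + 1) (phases G M T D k S y) then (1 : ℝ) else 0) ≤ δ := by
        refine (Finset.expect_le_expect fun y _ => ?_).trans h1
        by_cases hb' : bad (k + 1) (phases G M T D k S y)
        · rw [if_pos hb', if_pos]
          obtain ⟨v, hv, hd⟩ := hb'
          exact ⟨v, hv, hd.le⟩
        · rw [if_neg hb']
          split_ifs <;> norm_num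
      linarith

end Phase

end SampledLuby

namespace SampledLuby

/-! ### Waking times: dyadic midpoints -/

section Schedule

open Classical in
/-- The first time from `n` on at which `W` holds. -/
noncomputable def nextWake (W : ℕ → Prop) (n : ℕ) : Option ℕ :=
  if h : ∃ r, n ≤ r ∧ W r then some (Nat.find h) else none

theorem nextWake_eq_some_iff {W : ℕ → Prop} {n r : ℕ} :
    nextWake W n = some r ↔ n ≤ r ∧ W r ∧ ∀ k, n ≤ k → k < r → ¬ W k := by
  classical
  unfold nextWake
  split_ifs with h
  · rw [Option.some.injEq]
    constructor
    · rintro rfl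
      exact ⟨(Nat.find_spec h).1, (Nat.find_spec h).2, fun k hk hlt hW =>
        Nat.find_min h hlt ⟨hk, hW⟩⟩
    · rintro ⟨h1, h2, h3⟩
      rw [Nat.find_eq_iff]
      exact ⟨⟨h1, h2⟩, fun k hk hkW => h3 k hkW.1 hk hkW.2⟩
  · refine ⟨fun h' => by simp at h', fun h' => absurd ⟨r, h'.1, h'.2.1⟩ h⟩

theorem nextWake_self {W : ℕ → Prop} {n : ℕ} : nextWake W n = some n ↔ W n := by
  rw [nextWake_eq_some_iff]
  exact ⟨fun h => h.2.1, fun h => ⟨le_rfl, h, fun k h1 h2 => absurd h1 (not_le.2 h2)⟩⟩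

theorem nextWake_succ {W : ℕ → Prop} {n : ℕ} (h : ¬ W n) : nextWake W n = nextWake W (n + 1) := by
  ext r
  rw [nextWake_eq_some_iff, nextWake_eq_some_iff]
  constructor
  · rintro ⟨h1, h2, h3⟩
    have : n ≠ r := fun e => h (e ▸ h2)
    exact ⟨by omega, h2, fun k hk => h3 k (by omega)⟩
  · rintro ⟨h1, h2, h3⟩
    refine ⟨by omega, h2, fun k hk hkr => ?_⟩
    rcases Nat.eq_or_lt_of_le hk with rfl | hlt
    · exact h
    · exact h3 k hlt hkr

theorem nextWake_eq_none {W : ℕ → Prop} {n : ℕ} (h : ∀ r, n ≤ r → ¬ W r) : nextWake W n = none := by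
  rw [Option.eq_none_iff_forall_ne_some]
  intro r hr
  rw [nextWake_eq_some_iff] at hr
  exact h r hr.1 hr.2.1

/-- The midpoint of the dyadic interval of length `2 ^ (j + 1)` that contains `t`. -/
def mid (j t : ℕ) : ℕ := t / 2 ^ (j + 1) * 2 ^ (j + 1) + 2 ^ j

/-- Two different times have a common midpoint that separates them. -/
theorem exists_common_mid {L s t : ℕ} (hst : s < t) (ht : t < 2 ^ L) :
    ∃ j < L, mid j s = mid j t ∧ s < mid j t ∧ mid j t ≤ t := by
  classical
  have hex : ∃ k, s / 2 ^ k = t / 2 ^ k :=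
    ⟨L, by rw [Nat.div_eq_of_lt ht, Nat.div_eq_of_lt (hst.trans ht)]⟩
  -- The smallest dyadic interval containing both times has them in different halves, so its
  -- midpoint separates them.
  obtain ⟨k, hk, hmin⟩ : ∃ k, s / 2 ^ k = t / 2 ^ k ∧ ∀ k' < k, s / 2 ^ k' ≠ t / 2 ^ k' :=
    ⟨Nat.find hex, Nat.find_spec hex, fun k' hk' => Nat.find_min hex hk'⟩
  have hkL : k ≤ L := by
    by_contra hcon
    exact hmin L (not_le.1 hcon) (by rw [Nat.div_eq_of_lt ht, Nat.div_eq_of_lt (hst.trans ht)])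
  rcases k with _ | j
  · simp at hk; omega
  · refine ⟨j, by omega, by simp only [mid, hk], ?_⟩
    have hne := hmin j (Nat.lt_succ_self j)
    have hpos : 0 < 2 ^ j := by positivity
    have hs2 : s / 2 ^ (j + 1) = s / 2 ^ j / 2 := by rw [pow_succ, Nat.div_div_eq_div_mul]
    have ht2 : t / 2 ^ (j + 1) = t / 2 ^ j / 2 := by rw [pow_succ, Nat.div_div_eq_div_mul]
    have hle : s / 2 ^ j ≤ t / 2 ^ j := Nat.div_le_div_right hst.le
    set a := s / 2 ^ j with ha
    set b := t / 2 ^ j with hb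
    set q := t / 2 ^ (j + 1) with hq
    have hb' : b = 2 * q + 1 := by omega
    have ha' : a = 2 * q := by omega
    have h1 : mid j t = b * 2 ^ j := by
      rw [mid, ← hq, hb', pow_succ]; ring
    rw [h1]
    refine ⟨?_, Nat.div_mul_le_self t _⟩
    have h2 := Nat.lt_mul_div_succ s hpos
    rw [← ha, ha', ← hb', mul_comm] at h2
    exact h2

/-- `t` is the first step of phase `i` in which the value is below the threshold. -/
def Hit (m : ℕ → ℕ) (y : ℕ → ℕ → ℕ) (i t : ℕ) : Prop := y i t < m i ∧ ∀ s < t, m i ≤ y i s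

theorem Hit.unique {m : ℕ → ℕ} {y : ℕ → ℕ → ℕ} {i s t : ℕ} (hs : Hit m y i s) (ht : Hit m y i t) :
    s = t := by
  rcases lt_trichotomy s t with h | h | h
  · exact absurd hs.1 (not_lt.2 (ht.2 s h))
  · exact h
  · exact absurd ht.1 (not_lt.2 (hs.2 t h))

/-- The rounds in which a node with values `y` is awake. Step `n` consists of the rounds `2 * n`
(joined nodes announce themselves) and `2 * n + 1` (nodes that are hit compete). -/
def Wakes (L P : ℕ) (m : ℕ → ℕ) (y : ℕ → ℕ → ℕ) (r : ℕ) : Prop :=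
  r < 2 * (P * 2 ^ L) ∧
    ((r % 2 = 0 ∧ (r / 2 % 2 ^ L = 0 ∨
        ∃ t < 2 ^ L, Hit m y (r / 2 / 2 ^ L) t ∧ ∃ j < L, r / 2 % 2 ^ L = mid j t)) ∨
      (r % 2 = 1 ∧ Hit m y (r / 2 / 2 ^ L) (r / 2 % 2 ^ L)))

theorem wakes_odd {L P : ℕ} {m : ℕ → ℕ} {y : ℕ → ℕ → ℕ} {n : ℕ} :
    Wakes L P m y (2 * n + 1) ↔ n < P * 2 ^ L ∧ Hit m y (n / 2 ^ L) (n % 2 ^ L) := by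
  have h1 : (2 * n + 1) / 2 = n := by omega
  have h2 : (2 * n + 1) % 2 = 1 := by omega
  unfold Wakes
  rw [h1, h2]
  constructor
  · rintro ⟨h, h' | h'⟩
    · omega
    · exact ⟨by omega, h'.2⟩
  · rintro ⟨h, h'⟩
    exact ⟨by omega, Or.inr ⟨rfl, h'⟩⟩

theorem wakes_even {L P : ℕ} {m : ℕ → ℕ} {y : ℕ → ℕ → ℕ} {n : ℕ} :
    Wakes L P m y (2 * n) ↔ n < P * 2 ^ L ∧ (n % 2 ^ L = 0 ∨
        ∃ t < 2 ^ L, Hit m y (n / 2 ^ L) t ∧ ∃ j < L, n % 2 ^ L = mid j t) := by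
  have h1 : 2 * n / 2 = n := by omega
  have h2 : 2 * n % 2 = 0 := by omega
  unfold Wakes
  rw [h1, h2]
  constructor
  · rintro ⟨h, h' | h'⟩
    · exact ⟨by omega, h'.2⟩
    · omega
  · rintro ⟨h, h'⟩
    exact ⟨by omega, Or.inl ⟨rfl, h'⟩⟩

/-- Two nodes that compete in different steps share a round between these steps. -/
theorem exists_common_wake {L P : ℕ} {m : ℕ → ℕ} {y y' : ℕ → ℕ → ℕ} {n' n : ℕ} (hlt : n' < n)
    (h' : Wakes L P m y' (2 * n' + 1)) (h : Wakes L P m y (2 * n + 1)) :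
    ∃ k, n' < k ∧ k ≤ n ∧ Wakes L P m y' (2 * k) ∧ Wakes L P m y (2 * k) := by
  rw [wakes_odd] at h h'
  have hT : 0 < 2 ^ L := by positivity
  set T := 2 ^ L with hTdef
  have hn := Nat.div_add_mod n T
  have hn' := Nat.div_add_mod n' T
  have hmod := Nat.mod_lt n hT
  have hmod' := Nat.mod_lt n' hT
  have hdiv : n' / T ≤ n / T := Nat.div_le_div_right hlt.le
  -- Within one phase a common midpoint serves; across phases, the start of the later phase does.
  rcases Nat.eq_or_lt_of_le hdiv with he | hl
  · rw [he] at hn'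
    have hlt' : n' % T < n % T := by omega
    obtain ⟨j, hj, hmid, h1, h2⟩ := exists_common_mid hlt' (hTdef ▸ hmod)
    have hmT : mid j (n % T) < T := lt_of_le_of_lt h2 hmod
    have hk1 : (T * (n / T) + mid j (n % T)) / T = n / T := by
      rw [Nat.mul_add_div hT, Nat.div_eq_of_lt hmT, Nat.add_zero]
    have hk2 : (T * (n / T) + mid j (n % T)) % T = mid j (n % T) := by
      rw [Nat.mul_add_mod, Nat.mod_eq_of_lt hmT]
    refine ⟨T * (n / T) + mid j (n % T), by omega, by omega, ?_, ?_⟩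
    · rw [wakes_even, ← hTdef, hk1, hk2]
      exact ⟨by omega, Or.inr ⟨n' % T, hmod', he ▸ h'.2, j, hj, hmid.symm⟩⟩
    · rw [wakes_even, ← hTdef, hk1, hk2]
      exact ⟨by omega, Or.inr ⟨n % T, hmod, h.2, j, hj, rfl⟩⟩
  · have h1 : T * (n' / T + 1) ≤ T * (n / T) := Nat.mul_le_mul_left _ hl
    rw [mul_add, mul_one] at h1
    refine ⟨T * (n / T), by omega, by omega, ?_, ?_⟩ <;>
    · rw [wakes_even, ← hTdef, Nat.mul_mod_right]
      exact ⟨by omega, Or.inl rfl⟩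

-- A node is hit at most once per phase, so a phase costs its start, one competition and `L`
-- midpoints.
open Classical in
theorem card_wakes_le (L P : ℕ) (m : ℕ → ℕ) (y : ℕ → ℕ → ℕ) (R : ℕ) :
    ((Finset.range R).filter (Wakes L P m y)).card ≤ P * (L + 2) := by
  have hT : 0 < 2 ^ L := by positivity
  -- The default 0 is harmless: without a hit it only enlarges the covering set `B i`.
  let τ : ℕ → ℕ := fun i => if h : ∃ t, Hit m y i t then h.choose else 0
  have hτ : ∀ i t, Hit m y i t → t = τ i := by
    intro i t h
    have hex : ∃ t, Hit m y i t := ⟨t, h⟩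
    have : τ i = hex.choose := dif_pos hex
    rw [this]
    exact h.unique hex.choose_spec
  let B : ℕ → Finset ℕ := fun i =>
    insert (2 * (2 ^ L * i)) (insert (2 * (2 ^ L * i + τ i) + 1)
      ((Finset.range L).image fun j => 2 * (2 ^ L * i + mid j (τ i))))
  have hB : ∀ i, (B i).card ≤ L + 2 := by
    intro i
    refine (Finset.card_insert_le _ _).trans (Nat.succ_le_succ ?_)
    refine (Finset.card_insert_le _ _).trans (Nat.succ_le_succ ?_)
    exact Finset.card_image_le.trans_eq (Finset.card_range L)
  have hsub : (Finset.range R).filter (Wakes L P m y) ⊆ (Finset.range P).biUnion B := by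
    intro r hr
    obtain ⟨hlt, hcase⟩ := (Finset.mem_filter.1 hr).2
    have hn := Nat.div_add_mod (r / 2) (2 ^ L)
    rw [Finset.mem_biUnion]
    refine ⟨r / 2 / 2 ^ L, Finset.mem_range.2 ?_, ?_⟩
    · rw [Nat.div_lt_iff_lt_mul hT]; omega
    · rcases hcase with ⟨h0, h | ⟨t, _, hhit, j, hj, he⟩⟩ | ⟨h1, hhit⟩
      · refine Finset.mem_insert.2 (Or.inl ?_)
        omega
      · refine Finset.mem_insert_of_mem (Finset.mem_insert_of_mem (Finset.mem_image.2
          ⟨j, Finset.mem_range.2 hj, ?_⟩))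
        rw [← hτ _ _ hhit, ← he]
        omega
      · refine Finset.mem_insert_of_mem (Finset.mem_insert.2 (Or.inl ?_))
        rw [← hτ _ _ hhit]
        omega
  refine (Finset.card_le_card hsub).trans ?_
  refine (Finset.card_biUnion_le_card_mul _ _ _ fun i _ => hB i).trans_eq ?_
  rw [Finset.card_range]

end Schedule

/-! ### The algorithm and its round-by-round behaviour -/

section Algorithm

/-- The memory of a node: its random values, the number of elapsed rounds when it was written,
whether the node has joined, and whether it knows that a neighbour has joined. -/
structure Memory (Seed : Type) where
  seed : Seed
  now : ℕ
  joined : Bool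
  dominated : Bool

/-- The value of step `t` of phase `i`; it exceeds all thresholds outside the valid range. -/
def value {P T b : ℕ} (ω : Fin P → Fin T → Fin (2 ^ b)) (i t : ℕ) : ℕ :=
  if h : i < P ∧ t < T then ω ⟨i, h.1⟩ ⟨t, h.2⟩ else 2 ^ b

/-- The value that is used in round `r`. -/
def roundValue {P L b : ℕ} (ω : Fin P → Fin (2 ^ L) → Fin (2 ^ b)) (r : ℕ) : ℕ :=
  value ω (r / 2 / 2 ^ L) (r / 2 % 2 ^ L)

open Classical in
/-- The sampled Luby algorithm with `P` phases of `2 ^ L` steps, random values of `b` bits and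
threshold `m i` in phase `i`. -/
noncomputable def algorithm (b L P : ℕ) (m : ℕ → ℕ) : SleepingAlgorithm where
  Seed := Fin P → Fin (2 ^ L) → Fin (2 ^ b)
  seedCountable := inferInstance
  coin := PMF.uniformOfFintype _
  bandwidth := b
  State := Memory (Fin P → Fin (2 ^ L) → Fin (2 ^ b))
  init _ _ ω := ⟨ω, 0, false, false⟩
  sleep s := (nextWake (Wakes L P m (value s.seed)) s.now).map fun r => r - s.now
  send s _ := (nextWake (Wakes L P m (value s.seed)) s.now).bind fun r =>
    if r % 2 = 0 then (if s.joined then some 0 else none)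
    else if s.joined ∨ s.dominated then none
    else some (BitVec.ofNat b (roundValue s.seed r))
  -- The transition function is not given the round number; it is recovered from the seed and `now`.
  -- The default `s` concerns only nodes without a further waking round.
  step s msgs := ((nextWake (Wakes L P m (value s.seed)) s.now).map fun r =>
    if r % 2 = 0 then
      { s with now := r + 1, dominated := s.dominated || decide msgs.Nonempty }
    else
      { s with
        now := r + 1
        joined := s.joined || (!s.dominated &&
          decide (∀ p ∈ msgs, roundValue s.seed r < p.2.toNat)) }).getD s
  output s := s.joined

variable {b L P : ℕ} {m : ℕ → ℕ} {V : Type} (G : SimpleGraph V) (ident : V → ℕ)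
  (ω : V → Fin P → Fin (2 ^ L) → Fin (2 ^ b))

/-- `v` has joined before round `r`. -/
def JoinedAt (m : ℕ → ℕ) (r : ℕ) (v : V) : Prop :=
  (((algorithm b L P m).config G ident ω r v).state : Memory _).joined = true

/-- `v` knows before round `r` that a neighbour has joined. -/
def DominatedAt (m : ℕ → ℕ) (r : ℕ) (v : V) : Prop :=
  (((algorithm b L P m).config G ident ω r v).state : Memory _).dominated = true

theorem config_succ_of_wake {r : ℕ} {v : V} (A : SleepingAlgorithm) (ω : V → A.Seed)
    (h : (A.config G ident ω r v).wake = some r) :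
    A.config G ident ω (r + 1) v =
      ⟨A.step (A.config G ident ω r v).state (A.inbox G ident r (A.config G ident ω r) v),
        (A.sleep (A.step (A.config G ident ω r v).state
          (A.inbox G ident r (A.config G ident ω r) v))).map (fun k => r + 1 + k)⟩ := by
  simp only [SleepingAlgorithm.config, if_pos h]

theorem config_succ_of_not_wake {r : ℕ} {v : V} (A : SleepingAlgorithm) (ω : V → A.Seed)
    (h : (A.config G ident ω r v).wake ≠ some r) :
    A.config G ident ω (r + 1) v = A.config G ident ω r v := by
  simp only [SleepingAlgorithm.config, if_neg h]

theorem map_add_map_sub_nextWake (W : ℕ → Prop) (n : ℕ) :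
    ((nextWake W n).map fun r => r - n).map (fun k => n + k) = nextWake W n := by
  cases h : nextWake W n with
  | none => rfl
  | some r =>
    have := (nextWake_eq_some_iff.1 h).1
    simp only [Option.map_some, Option.some.injEq]
    omega

theorem step_seed_now {s : Memory (Fin P → Fin (2 ^ L) → Fin (2 ^ b))} {r : ℕ}
    (h : nextWake (Wakes L P m (value s.seed)) s.now = some r) (I : Set (ℕ × BitVec b)) :
    ((algorithm b L P m).step s I : Memory _).seed = s.seed ∧
      ((algorithm b L P m).step s I : Memory _).now = r + 1 := by
  simp only [algorithm, h, Option.map_some, Option.getD_some]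
  split_ifs <;> exact ⟨rfl, rfl⟩

/-- The field `now` is 0 or the end of the last awake round. No waking round lies between it and
`r`, so the next one is the same counted from either. -/
theorem config_spec (r : ℕ) (v : V) :
    (((algorithm b L P m).config G ident ω r v).state : Memory _).seed = ω v ∧
    ((algorithm b L P m).config G ident ω r v).wake =
      nextWake (Wakes L P m (value (ω v)))
        (((algorithm b L P m).config G ident ω r v).state : Memory _).now ∧
    ((algorithm b L P m).config G ident ω r v).wake =
      nextWake (Wakes L P m (value (ω v))) r := by
  induction r with
  | zero =>
    have := map_add_map_sub_nextWake (Wakes L P m (value (ω v))) 0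
    simp only [Nat.zero_add, Option.map_id'] at this
    exact ⟨rfl, this, this⟩
  | succ r ih =>
    obtain ⟨h1, h2, h3⟩ := ih
    by_cases h : ((algorithm b L P m).config G ident ω r v).wake = some r
    · rw [config_succ_of_wake G ident (algorithm b L P m) ω h]
      have hn : nextWake (Wakes L P m (value
          (((algorithm b L P m).config G ident ω r v).state : Memory _).seed))
          (((algorithm b L P m).config G ident ω r v).state : Memory _).now = some r := by
        rw [h1, ← h2, h]
      obtain ⟨hs, ht⟩ := step_seed_now hn ((algorithm b L P m).inbox G ident r
        ((algorithm b L P m).config G ident ω r) v)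
      have hsleep : ((algorithm b L P m).sleep ((algorithm b L P m).step
          ((algorithm b L P m).config G ident ω r v).state ((algorithm b L P m).inbox G ident r
          ((algorithm b L P m).config G ident ω r) v))).map (fun k => r + 1 + k) =
          nextWake (Wakes L P m (value (ω v))) (r + 1) := by
        have := map_add_map_sub_nextWake (Wakes L P m (value (ω v))) (r + 1)
        rw [← h1, ← hs, ← ht] at this
        rw [← h1, ← hs, ← ht]
        exact this
      refine ⟨hs.trans h1, ?_, hsleep⟩
      rw [ht]
      exact hsleep
    · rw [config_succ_of_not_wake G ident (algorithm b L P m) ω h]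
      refine ⟨h1, h2, ?_⟩
      rw [h3, nextWake_succ]
      intro hW
      exact h (h3.trans (nextWake_self.2 hW))

theorem wake_eq_some_iff (r : ℕ) (v : V) :
    ((algorithm b L P m).config G ident ω r v).wake = some r ↔
      Wakes L P m (value (ω v)) r := by
  rw [(config_spec G ident ω r v).2.2, nextWake_self]

theorem nextWake_state {r : ℕ} {v : V} (h : Wakes L P m (value (ω v)) r) :
    nextWake (Wakes L P m (value
      (((algorithm b L P m).config G ident ω r v).state : Memory _).seed))
      (((algorithm b L P m).config G ident ω r v).state : Memory _).now = some r := by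
  obtain ⟨h1, h2, h3⟩ := config_spec (m := m) G ident ω r v
  rw [h1, ← h2, h3, nextWake_self]
  exact h

theorem send_state_even {r : ℕ} {u : V} (h : Wakes L P m (value (ω u)) r) (hr : r % 2 = 0)
    (i : ℕ) (c : BitVec b) :
    (algorithm b L P m).send ((algorithm b L P m).config G ident ω r u).state i = some c ↔
      JoinedAt G ident ω m r u ∧ c = 0 := by
  have hn := nextWake_state G ident ω h
  rw [JoinedAt]
  set s : Memory _ := ((algorithm b L P m).config G ident ω r u).state
  change (nextWake (Wakes L P m (value s.seed)) s.now).bind _ = _ ↔ _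
  rw [hn, Option.bind_some, if_pos hr]
  by_cases hj : s.joined = true
  · rw [if_pos hj, Option.some.injEq]
    exact ⟨fun h => ⟨hj, h.symm⟩, fun h => h.2.symm⟩
  · simp [hj]

theorem send_state_odd {r : ℕ} {u : V} (h : Wakes L P m (value (ω u)) r) (hr : r % 2 = 1)
    (i : ℕ) (c : BitVec b) :
    (algorithm b L P m).send ((algorithm b L P m).config G ident ω r u).state i = some c ↔
      ¬ JoinedAt G ident ω m r u ∧ ¬ DominatedAt G ident ω m r u ∧
        c = BitVec.ofNat b (roundValue (ω u) r) := by
  have hn := nextWake_state G ident ω h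
  have hs := (config_spec (m := m) G ident ω r u).1
  rw [JoinedAt, DominatedAt]
  set s : Memory _ := ((algorithm b L P m).config G ident ω r u).state
  change (nextWake (Wakes L P m (value s.seed)) s.now).bind _ = _ ↔ _
  rw [hn, Option.bind_some, if_neg (by omega), hs]
  by_cases hj : s.joined = true
  · simp [hj]
  · by_cases hd : s.dominated = true
    · simp [hd]
    · rw [if_neg (by tauto), Option.some.injEq]
      exact ⟨fun h => ⟨hj, hd, h.symm⟩, fun h => h.2.2.symm⟩

theorem step_even {r : ℕ} {v : V} (hr : r % 2 = 0) :
    (JoinedAt G ident ω m (r + 1) v ↔ JoinedAt G ident ω m r v) ∧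
    (DominatedAt G ident ω m (r + 1) v ↔ DominatedAt G ident ω m r v ∨
      (Wakes L P m (value (ω v)) r ∧ ∃ u, G.Adj v u ∧ Wakes L P m (value (ω u)) r ∧
        JoinedAt G ident ω m r u)) := by
  by_cases h : Wakes L P m (value (ω v)) r
  · have hinbox : ((algorithm b L P m).inbox G ident r
        ((algorithm b L P m).config G ident ω r) v).Nonempty ↔
        ∃ u, G.Adj v u ∧ Wakes L P m (value (ω u)) r ∧ JoinedAt G ident ω m r u := by
      constructor
      · rintro ⟨p, u, hadj, hw, _, hsend⟩
        rw [wake_eq_some_iff] at hw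
        exact ⟨u, hadj, hw, ((send_state_even G ident ω hw hr _ _).1 hsend).1⟩
      · rintro ⟨u, hadj, hw, hj⟩
        exact ⟨(ident u, (0 : BitVec b)), u, hadj, (wake_eq_some_iff G ident ω r u).2 hw, rfl,
          (send_state_even G ident ω hw hr _ _).2 ⟨hj, rfl⟩⟩
    have hn := nextWake_state G ident ω h
    simp only [h, true_and]
    rw [← hinbox]
    simp only [JoinedAt, DominatedAt]
    rw [config_succ_of_wake G ident (algorithm b L P m) ω ((wake_eq_some_iff G ident ω r v).2 h)]
    set I := (algorithm b L P m).inbox G ident r ((algorithm b L P m).config G ident ω r) v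
    set s : Memory _ := ((algorithm b L P m).config G ident ω r v).state
    have hstep : (algorithm b L P m).step s I =
        ({ s with
            now := r + 1
            dominated := (s.dominated || @decide I.Nonempty (Classical.propDecidable _)) } :
          Memory _) := by
      simp only [algorithm, hn, Option.map_some, Option.getD_some, if_pos hr]
      rfl
    simp only [hstep]
    simp
  · have hw := config_succ_of_not_wake G ident (algorithm b L P m) ω
      (mt (wake_eq_some_iff G ident ω r v).1 h)
    simp only [JoinedAt, DominatedAt, hw, h, false_and, or_false, and_self]

/-- A competing value lies below the threshold, hence survives its encoding in `b` bits. -/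
theorem roundValue_lt {r : ℕ} {u : V} (hm : ∀ i, m i ≤ 2 ^ b)
    (h : Wakes L P m (value (ω u)) r) (hr : r % 2 = 1) : roundValue (ω u) r < 2 ^ b := by
  rcases h.2 with h' | h'
  · omega
  · exact lt_of_lt_of_le h'.2.1 (hm _)

theorem step_odd {r : ℕ} {v : V} (hm : ∀ i, m i ≤ 2 ^ b) (hr : r % 2 = 1) :
    (DominatedAt G ident ω m (r + 1) v ↔ DominatedAt G ident ω m r v) ∧
    (JoinedAt G ident ω m (r + 1) v ↔ JoinedAt G ident ω m r v ∨
      (Wakes L P m (value (ω v)) r ∧ ¬ DominatedAt G ident ω m r v ∧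
        ∀ u, G.Adj v u → Wakes L P m (value (ω u)) r → ¬ JoinedAt G ident ω m r u →
          ¬ DominatedAt G ident ω m r u → roundValue (ω v) r < roundValue (ω u) r)) := by
  by_cases h : Wakes L P m (value (ω v)) r
  · have hval : ∀ u, Wakes L P m (value (ω u)) r →
        (BitVec.ofNat b (roundValue (ω u) r)).toNat = roundValue (ω u) r := fun u hw => by
      rw [BitVec.toNat_ofNat, Nat.mod_eq_of_lt (roundValue_lt ω hm hw hr)]
    have hinbox : (∀ p ∈ (algorithm b L P m).inbox G ident r
        ((algorithm b L P m).config G ident ω r) v,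
          roundValue (ω v) r < (p.2 : BitVec b).toNat) ↔
        ∀ u, G.Adj v u → Wakes L P m (value (ω u)) r → ¬ JoinedAt G ident ω m r u →
          ¬ DominatedAt G ident ω m r u → roundValue (ω v) r < roundValue (ω u) r := by
      constructor
      · intro hp u hadj hw hj hd
        have h' : roundValue (ω v) r < (BitVec.ofNat b (roundValue (ω u) r)).toNat :=
          hp (ident u, BitVec.ofNat b (roundValue (ω u) r)) ⟨u, hadj, (wake_eq_some_iff G ident ω r u).2 hw, rfl,
            (send_state_odd G ident ω hw hr _ _).2 ⟨hj, hd, rfl⟩⟩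
        rwa [hval u hw] at h'
      · rintro hall p ⟨u, hadj, hw, _, hsend⟩
        rw [wake_eq_some_iff] at hw
        obtain ⟨hj, hd, hc⟩ := (send_state_odd G ident ω hw hr _ _).1 hsend
        rw [hc]
        exact lt_of_lt_of_eq (hall u hadj hw hj hd) (hval u hw).symm
    have hn := nextWake_state G ident ω h
    have hs := (config_spec (m := m) G ident ω r v).1
    simp only [h, true_and]
    rw [← hinbox]
    simp only [JoinedAt, DominatedAt]
    rw [config_succ_of_wake G ident (algorithm b L P m) ω ((wake_eq_some_iff G ident ω r v).2 h)]
    set I := (algorithm b L P m).inbox G ident r ((algorithm b L P m).config G ident ω r) v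
    set s : Memory _ := ((algorithm b L P m).config G ident ω r v).state
    have hstep : (algorithm b L P m).step s I =
        ({ s with
            now := r + 1
            joined := (s.joined || (!s.dominated && @decide (∀ p ∈ I, roundValue s.seed r <
              (p.2 : BitVec b).toNat) (Classical.propDecidable _))) } : Memory _) := by
      simp only [algorithm, hn, Option.map_some, Option.getD_some]
      rw [if_neg (by omega)]
      rfl
    have hs' : roundValue s.seed r = roundValue (ω v) r := congrArg (fun z => roundValue z r) hs
    simp only [hstep, ← hs']
    simp only [Bool.or_eq_true, Bool.and_eq_true, Bool.not_eq_true', decide_eq_true_eq,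
      Bool.not_eq_true]
    exact ⟨trivial, trivial⟩
  · have hw := config_succ_of_not_wake G ident (algorithm b L P m) ω
      (mt (wake_eq_some_iff G ident ω r v).1 h)
    simp only [JoinedAt, DominatedAt, hw, h, false_and, or_false, and_self]

end Algorithm

end SampledLuby

namespace SampledLuby

/-! ### The distributed run equals the idealised process -/

section Simulation

variable {b L P : ℕ} {m : ℕ → ℕ} {V : Type} (G : SimpleGraph V) (ident : V → ℕ)
  (ω : V → Fin P → Fin (2 ^ L) → Fin (2 ^ b))

theorem step_mono (hm : ∀ i, m i ≤ 2 ^ b) (r : ℕ) (v : V) :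
    (JoinedAt G ident ω m r v → JoinedAt G ident ω m (r + 1) v) ∧
    (DominatedAt G ident ω m r v → DominatedAt G ident ω m (r + 1) v) := by
  rcases Nat.mod_two_eq_zero_or_one r with hr | hr
  · have h := step_even G ident ω (m := m) (v := v) hr
    exact ⟨h.1.2, fun h' => h.2.2 (Or.inl h')⟩
  · have h := step_odd G ident ω (v := v) hm hr
    exact ⟨fun h' => h.2.2 (Or.inl h'), h.1.2⟩

theorem joinedAt_mono (hm : ∀ i, m i ≤ 2 ^ b) {r r' : ℕ} (h : r ≤ r') {v : V}
    (hv : JoinedAt G ident ω m r v) : JoinedAt G ident ω m r' v := by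
  induction h with
  | refl => exact hv
  | step _ ih => exact (step_mono G ident ω hm _ v).1 ih

theorem dominatedAt_mono (hm : ∀ i, m i ≤ 2 ^ b) {r r' : ℕ} (h : r ≤ r') {v : V}
    (hv : DominatedAt G ident ω m r v) : DominatedAt G ident ω m r' v := by
  induction h with
  | refl => exact hv
  | step _ ih => exact (step_mono G ident ω hm _ v).2 ih

theorem not_joinedAt_zero (v : V) : ¬ JoinedAt G ident ω m 0 v := Bool.false_ne_true

theorem exists_joinedAt_of_dominatedAt (hm : ∀ i, m i ≤ 2 ^ b) {r : ℕ} {v : V}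
    (h : DominatedAt G ident ω m r v) : ∃ u, G.Adj v u ∧ JoinedAt G ident ω m r u := by
  induction r with
  | zero => exact absurd h Bool.false_ne_true
  | succ r ih =>
    have lift : (∃ u, G.Adj v u ∧ JoinedAt G ident ω m r u) →
        ∃ u, G.Adj v u ∧ JoinedAt G ident ω m (r + 1) u :=
      fun ⟨u, hu, hj⟩ => ⟨u, hu, (step_mono G ident ω hm r u).1 hj⟩
    rcases Nat.mod_two_eq_zero_or_one r with hr | hr
    · rcases (step_even G ident ω hr).2.1 h with h' | ⟨_, u, hu, _, hj⟩
      · exact lift (ih h')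
      · exact lift ⟨u, hu, hj⟩
    · exact lift (ih ((step_odd G ident ω hm hr).1.1 h))

/-- A node that joins is awake in a competition round. -/
theorem exists_wakes_of_joinedAt (hm : ∀ i, m i ≤ 2 ^ b) {n : ℕ} {u : V}
    (h : JoinedAt G ident ω m (2 * n) u) :
    ∃ k < n, Wakes L P m (value (ω u)) (2 * k + 1) ∧ JoinedAt G ident ω m (2 * (k + 1)) u := by
  induction n with
  | zero => exact absurd h (not_joinedAt_zero G ident ω u)
  | succ n ih =>
    have h' := (step_odd G ident ω (r := 2 * n + 1) (v := u) hm (by omega)).2.1 h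
    rcases h' with h' | h'
    · rw [(step_even G ident ω (r := 2 * n) (by omega)).1] at h'
      obtain ⟨k, hk, h1, h2⟩ := ih h'
      exact ⟨k, by omega, h1, h2⟩
    · exact ⟨n, by omega, h'.1, h⟩

/-- A competing node knows whether one of its neighbours has joined. -/
theorem dominatedAt_iff (hm : ∀ i, m i ≤ 2 ^ b) {n : ℕ} {v : V}
    (hw : Wakes L P m (value (ω v)) (2 * n + 1)) :
    DominatedAt G ident ω m (2 * n + 1) v ↔ ∃ u, G.Adj v u ∧ JoinedAt G ident ω m (2 * n) u := by
  constructor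
  · intro h
    obtain ⟨u, hu, hj⟩ := exists_joinedAt_of_dominatedAt G ident ω hm h
    exact ⟨u, hu, (step_even G ident ω (by omega)).1.1 hj⟩
  · rintro ⟨u, hu, hj⟩
    -- The neighbour joined in a step `k < n`; in the shared round after step `k` and before
    -- competition `n` it announces this and `v` hears it.
    obtain ⟨k, hk, hwk, hjk⟩ := exists_wakes_of_joinedAt G ident ω hm hj
    obtain ⟨l, hl1, hl2, hwu, hwv⟩ := exists_common_wake hk hwk hw
    have h1 : DominatedAt G ident ω m (2 * l + 1) v :=
      (step_even G ident ω (by omega)).2.2 (Or.inr ⟨hwv, u, hu, hwu,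
        joinedAt_mono G ident ω hm (by omega) hjk⟩)
    exact dominatedAt_mono G ident ω hm (by omega) h1

/-- The nodes that joined in the first `n` steps. -/
def joinedSet (m : ℕ → ℕ) (n : ℕ) : Set V := {v | JoinedAt G ident ω m (2 * n) v}

/-- The nodes that were hit in one of the first `t` steps of phase `i`. -/
def usedSet (m : ℕ → ℕ) (i t : ℕ) : Set V := {v | ∃ s < t, value (ω v) i s < m i}

/-- By `dominatedAt_iff`, the nodes that send a value are exactly the remaining, unused, sampled
ones, so the local test of a node sees all its rivals. -/
theorem joinedSet_succ (hm : ∀ i, m i ≤ 2 ^ b) {n : ℕ} (hn : n < P * 2 ^ L) :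
    joinedSet G ident ω m (n + 1) = joinedSet G ident ω m n ∪
      joins G (m (n / 2 ^ L)) (joinedSet G ident ω m n) (usedSet ω m (n / 2 ^ L) (n % 2 ^ L))
        (fun v => value (ω v) (n / 2 ^ L) (n % 2 ^ L)) := by
  have hround : ∀ v, roundValue (ω v) (2 * n + 1) = value (ω v) (n / 2 ^ L) (n % 2 ^ L) := by
    intro v
    have : (2 * n + 1) / 2 = n := by omega
    rw [roundValue, this]
  have hhit : ∀ v, Wakes L P m (value (ω v)) (2 * n + 1) ↔
      value (ω v) (n / 2 ^ L) (n % 2 ^ L) < m (n / 2 ^ L) ∧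
        v ∉ usedSet ω m (n / 2 ^ L) (n % 2 ^ L) := by
    intro v
    rw [wakes_odd, Hit, usedSet]
    simp only [Set.mem_ofPred_eq, not_exists, not_and, not_lt]
    exact ⟨fun h => h.2, fun h => ⟨hn, h⟩⟩
  have hj : ∀ v, JoinedAt G ident ω m (2 * n + 1) v ↔ v ∈ joinedSet G ident ω m n := fun v =>
    (step_even G ident ω (by omega)).1
  ext v
  rw [Set.mem_union]
  have hstep := (step_odd G ident ω (r := 2 * n + 1) (v := v) hm (by omega)).2
  rw [hj] at hstep
  refine hstep.trans ?_
  by_cases hv : v ∈ joinedSet G ident ω m n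
  · simp only [hv, true_or]
  simp only [hv, false_or]
  constructor
  · rintro ⟨hw, hd, hall⟩
    rw [dominatedAt_iff G ident ω hm hw] at hd
    have hwv := (hhit v).1 hw
    refine ⟨⟨hv, fun u hu hadj => hd ⟨u, hadj, hu⟩⟩, hwv.2, hwv.1, ?_⟩
    intro w hadj hrem hused
    -- A neighbour that is not sampled sleeps through the competition, but its value is at least the
    -- threshold and loses anyway.
    by_cases hlt : value (ω w) (n / 2 ^ L) (n % 2 ^ L) < m (n / 2 ^ L)
    · have hww := (hhit w).2 ⟨hlt, hused⟩
      have := hall w hadj hww (fun h => hrem.1 ((hj w).1 h)) (fun h => by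
        rw [dominatedAt_iff G ident ω hm hww] at h
        obtain ⟨u, hu, hju⟩ := h
        exact hrem.2 u hju hu)
      rwa [hround, hround] at this
    · exact lt_of_lt_of_le hwv.1 (not_lt.1 hlt)
  · rintro ⟨hrem, hused, hlt, hall⟩
    have hw := (hhit v).2 ⟨hlt, hused⟩
    refine ⟨hw, ?_, ?_⟩
    · rw [dominatedAt_iff G ident ω hm hw]
      rintro ⟨u, hu, hju⟩
      exact hrem.2 u hju hu
    · intro u hadj hwu hju hdu
      rw [hround, hround]
      refine hall u hadj ⟨fun h => hju ((hj u).2 h), fun w hw' hadj' => hdu ?_⟩ ((hhit u).1 hwu).2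
      rw [dominatedAt_iff G ident ω hm hwu]
      exact ⟨w, hadj', hw'⟩

theorem isIndepSet_joinedSet (hm : ∀ i, m i ≤ 2 ^ b) {n : ℕ} (hn : n ≤ P * 2 ^ L) :
    G.IsIndepSet (joinedSet G ident ω m n) := by
  induction n with
  | zero => exact fun v hv => absurd hv (not_joinedAt_zero G ident ω v)
  | succ n ih =>
    rw [joinedSet_succ G ident ω hm hn]
    intro u hu v hv hne hadj
    rcases hu with hu | hu <;> rcases hv with hv | hv
    · exact ih (by omega) hu hv hne hadj
    · exact hv.1.2 u hu hadj.symm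
    · exact hu.1.2 v hv hadj
    · exact lt_asymm (hu.2.2.2 v hadj hv.1 hv.2.1) (hv.2.2.2 u hadj.symm hu.1 hu.2.1)

/-- The values, sorted by phases and steps first. -/
def sorted {X : Type} (P T : ℕ) : (V → Fin P → Fin T → X) ≃ (Fin P → Fin T → V → X) where
  toFun ω i t v := ω v i t
  invFun y v i t := y i t v
  left_inv _ := rfl
  right_inv _ := rfl

/-- Hits are counted separately in each phase, which is why the idealised process restarts with no
used nodes. -/
theorem run_phaseStep (hm : ∀ i, m i ≤ 2 ^ b) {i : ℕ} (hi : i < P) {n : ℕ} (hn : n ≤ 2 ^ L)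
    (y : Fin n → V → Fin (2 ^ b)) (hy : ∀ t v, (y t v : ℕ) = value (ω v) i t) :
    run (phaseStep G (m i) (2 ^ b)) (joinedSet G ident ω m (i * 2 ^ L), ∅) n y =
      (joinedSet G ident ω m (i * 2 ^ L + n), usedSet ω m i n) := by
  induction n with
  | zero =>
    refine Prod.ext rfl ?_
    simp [run, usedSet]
  | succ n ih =>
    have hT : 0 < 2 ^ L := by positivity
    have h1 : (i * 2 ^ L + n) / 2 ^ L = i := by
      rw [mul_comm, Nat.mul_add_div hT, Nat.div_eq_of_lt (by omega), Nat.add_zero]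
    have h2 : (i * 2 ^ L + n) % 2 ^ L = n := by
      rw [mul_comm, Nat.mul_add_mod, Nat.mod_eq_of_lt (by omega)]
    have hlt : i * 2 ^ L + n < P * 2 ^ L := by
      have := Nat.mul_le_mul_right (2 ^ L) hi
      rw [Nat.succ_mul] at this
      omega
    rw [run, ih (by omega) (Fin.init y) (fun t v => hy t.castSucc v), ← add_assoc,
      joinedSet_succ G ident ω hm hlt, h1, h2, phaseStep, lubyStep]
    have hfun : (fun v => (y (Fin.last n) v : ℕ)) = fun v => value (ω v) i n := by
      ext v; exact hy (Fin.last n) v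
    rw [hfun]
    refine Prod.ext rfl ?_
    ext v
    simp only [usedSet, Set.mem_union, Set.mem_ofPred_eq]
    constructor
    · rintro (⟨s, hs, h⟩ | h)
      · exact ⟨s, by omega, h⟩
      · exact ⟨n, by omega, hy (Fin.last n) v ▸ h⟩
    · rintro ⟨s, hs, h⟩
      rcases Nat.eq_or_lt_of_le (Nat.lt_succ_iff.1 hs) with rfl | hs'
      · exact Or.inr ((hy (Fin.last s) v).symm ▸ h)
      · exact Or.inl ⟨s, hs', h⟩

theorem run_phases (D : ℕ → ℕ) (hm : ∀ i, m i = 2 ^ b / D (i + 1)) {n : ℕ} (hn : n ≤ P)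
    (y : Fin n → Fin (2 ^ L) → V → Fin (2 ^ b))
    (hy : ∀ (i : Fin n) t v, y i t v = ω v (i.castLE hn) t) :
    run (phases G (2 ^ b) (2 ^ L) D) ∅ n y = joinedSet G ident ω m (n * 2 ^ L) := by
  have hm' : ∀ i, m i ≤ 2 ^ b := fun i => hm i ▸ Nat.div_le_self _ _
  induction n with
  | zero =>
    rw [run, Nat.zero_mul]
    exact (Set.eq_empty_iff_forall_notMem.2 (not_joinedAt_zero G ident ω)).symm
  | succ n ih =>
    rw [run, ih (by omega) (Fin.init y) (fun i t v => hy i.castSucc t v), phases, ← hm,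
      run_phaseStep G ident ω hm' hn le_rfl, Nat.succ_mul]
    intro t v
    rw [hy, value, dif_pos ⟨hn, t.2⟩]
    rfl

end Simulation

/-! ### Termination, energy and the final output -/

section Correctness

variable {b L P : ℕ} {m : ℕ → ℕ} {V : Type} (G : SimpleGraph V) (ident : V → ℕ)
  (ω : V → Fin P → Fin (2 ^ L) → Fin (2 ^ b))

theorem wake_eq_none {R : ℕ} (hR : 2 * (P * 2 ^ L) ≤ R) (v : V) :
    ((algorithm b L P m).config G ident ω R v).wake = none := by
  rw [(config_spec G ident ω R v).2.2]
  exact nextWake_eq_none fun r hr hW => absurd hW.1 (by omega)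

theorem awakeRounds_le (R : ℕ) (v : V) :
    (algorithm b L P m).awakeRounds G ident ω R v ≤ P * (L + 2) := by
  classical
  refine le_trans (le_of_eq ?_) (card_wakes_le L P m (value (ω v)) R)
  unfold SleepingAlgorithm.awakeRounds SleepingAlgorithm.Awake
  simp only [wake_eq_some_iff]

theorem outputSet_eq {R : ℕ} (hR : 2 * (P * 2 ^ L) ≤ R) :
    (algorithm b L P m).outputSet G ident ω R = joinedSet G ident ω m (P * 2 ^ L) := by
  induction hR with
  | refl => rfl
  | step h ih =>
    rw [← ih]
    ext v
    have := config_succ_of_not_wake (v := v) G ident (algorithm b L P m) ω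
      (by rw [wake_eq_none G ident ω h v]; simp)
    simp only [SleepingAlgorithm.outputSet, Set.mem_ofPred_eq, Nat.succ_eq_add_one, this]

end Correctness

end SampledLuby

namespace SampledLuby

/-! ### From the product law to averages -/

section Probability

open scoped BigOperators

open Classical in
theorem pi_uniform_real {V S : Type} [Fintype V] [Fintype S] [Nonempty S] [MeasurableSpace S]
    [MeasurableSingletonClass S] (E : Set (V → S)) :
    (Measure.pi (fun _ : V => (PMF.uniformOfFintype S).toMeasure)).real E =
      𝔼 x : V → S, if x ∈ E then (1 : ℝ) else 0 := by
  set μ := Measure.pi (fun _ : V => (PMF.uniformOfFintype S).toMeasure) with hμ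
  have hs : ∀ x : V → S, μ.real {x} = (Fintype.card (V → S) : ℝ)⁻¹ := by
    intro x
    rw [measureReal_def, hμ, Measure.pi_singleton]
    simp only [PMF.toMeasure_apply_singleton _ _ (measurableSet_singleton _),
      PMF.uniformOfFintype_apply, Finset.prod_const, Finset.card_univ]
    simp
  have hE : E = ((Finset.univ.filter fun x => x ∈ E : Finset (V → S)) : Set (V → S)) := by
    ext x; simp
  rw [Fintype.expect_eq_sum_div_card, ← Finset.sum_filter, Finset.sum_const, nsmul_eq_mul, mul_one]
  conv_lhs => rw [hE]
  rw [← sum_measureReal_singleton, Finset.sum_congr rfl fun x _ => hs x, Finset.sum_const,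
    nsmul_eq_mul, div_eq_mul_inv]

end Probability

/-! ### All guarantees for a general sequence of degree bounds -/

section Main

open scoped BigOperators

open Classical in
theorem maxDegree_induce_le {V : Type} [Fintype V] (G : SimpleGraph V) (S : Set V) (k : ℕ)
    (h : ∀ v ∈ remainingNodes G S, (nbrs G S v).card ≤ k) :
    (G.induce (remainingNodes G S)).maxDegree ≤ k := by
  refine SimpleGraph.maxDegree_le_of_forall_degree_le _ k fun v => ?_
  refine le_trans ?_ (h v v.2)
  rw [← SimpleGraph.card_neighborFinset_eq_degree]
  refine Finset.card_le_card_of_injOn Subtype.val ?_ Subtype.val_injective.injOn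
  intro u hu
  rw [Finset.mem_coe, SimpleGraph.mem_neighborFinset] at hu
  exact mem_nbrs.2 ⟨hu, u.2⟩

/-- The guarantees of the sampled Luby algorithm for a sequence of degree bounds. -/
theorem reducesDegree_algorithm {N Δ b L P : ℕ} (D : ℕ → ℕ) {bits rounds energy prob deg : ℝ}
    (hbN : 4 * N ≤ 2 ^ b) (hD : ∀ i < P, 1 ≤ D (i + 1)) (hTD : ∀ i < P, 2 ^ L ≤ D (i + 1))
    (hΔ : ∀ i < P, 64 * 2 ^ L * D i ≤ D (i + 1) ^ 2) (hD0 : min Δ N ≤ D 0)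
    (hbits : (b : ℝ) ≤ bits) (hrounds : 2 * (P * 2 ^ L : ℝ) ≤ rounds)
    (henergy : (P * (L + 2) : ℝ) ≤ energy)
    (hprob : prob ≤ 1 - P * (2 * (N : ℝ) ^ 2 * (31 / 32) ^ (2 ^ L))) (hdeg : (D P : ℝ) ≤ deg) :
    ReducesDegree (algorithm b L P fun i => 2 ^ b / D (i + 1)) N Δ bits rounds energy prob deg := by
  classical
  refine ⟨hbits, ?_⟩
  intro V _ G ident hcard hmax _
  have hR : 2 * (P * 2 ^ L) ≤ ⌊rounds⌋₊ := by
    refine Nat.le_floor ?_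
    push_cast
    exact hrounds
  have hm : ∀ i, 2 ^ b / D (i + 1) ≤ 2 ^ b := fun i => Nat.div_le_self _ _
  refine ⟨fun ω => ⟨fun v => wake_eq_none G ident ω hR v, fun v => ?_, ?_⟩, ?_⟩
  · refine le_trans ?_ henergy
    exact_mod_cast awakeRounds_le G ident ω _ v
  · rw [outputSet_eq G ident ω hR]
    exact isIndepSet_joinedSet G ident ω hm le_rfl
  · let Seed := Fin P → Fin (2 ^ L) → Fin (2 ^ b)
    let good : Set (V → Seed) := {ω |
      ((G.induce (remainingNodes G ((algorithm b L P fun i => 2 ^ b / D (i + 1)).outputSet G ident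
        ω ⌊rounds⌋₊))).maxDegree : ℝ) ≤ deg}
    let _ : MeasurableSpace Seed := ⊤
    have _ : MeasurableSingletonClass Seed := ⟨fun _ => trivial⟩
    change prob ≤ (Measure.pi (fun _ : V => (PMF.uniformOfFintype Seed).toMeasure)).real good
    rw [pi_uniform_real]
    let bad : Set V → Prop := fun S => ∃ v ∈ remainingNodes G S, D P < (nbrs G S v).card
    have h0 : ∀ v, (nbrs G ∅ v).card ≤ D 0 := by
      intro v
      refine le_trans (le_min ?_ ((Finset.card_le_univ _).trans hcard)) hD0
      refine le_trans ?_ ((G.degree_le_maxDegree v).trans hmax)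
      rw [← SimpleGraph.card_neighborFinset_eq_degree]
      refine Finset.card_le_card fun u hu => ?_
      rw [SimpleGraph.mem_neighborFinset]
      exact (mem_nbrs.1 hu).1
    have hfail := expect_phases_failure (M := 2 ^ b) (T := 2 ^ L) (P := P) G D hcard hbN hD hTD hΔ h0
    have hswap : (𝔼 ω : V → Seed, if bad (run (phases G (2 ^ b) (2 ^ L) D) ∅ P (sorted P _ ω))
        then (1 : ℝ) else 0) = 𝔼 y : Fin P → Fin (2 ^ L) → V → Fin (2 ^ b),
          if bad (run (phases G (2 ^ b) (2 ^ L) D) ∅ P y) then (1 : ℝ) else 0 :=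
      Fintype.expect_equiv (sorted P (2 ^ L)) _ _ fun _ => rfl
    have hpoint : ∀ ω : V → Seed, (1 : ℝ) - (if bad (run (phases G (2 ^ b) (2 ^ L) D) ∅ P
        (sorted P _ ω)) then (1 : ℝ) else 0) ≤ if ω ∈ good then (1 : ℝ) else 0 := by
      intro ω
      by_cases hg : ω ∈ good
      · rw [if_pos hg]
        split_ifs <;> norm_num
      · rw [if_neg hg, if_pos]
        · norm_num
        · rw [run_phases (m := fun i => 2 ^ b / D (i + 1)) G ident ω D (fun _ => rfl) le_rfl
            (sorted P _ ω) (fun i t v => rfl)]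
          by_contra hb
          refine hg (le_trans ?_ hdeg)
          rw [outputSet_eq G ident ω hR, Nat.cast_le]
          refine maxDegree_induce_le G _ _ fun v hv => ?_
          by_contra hcon
          exact hb ⟨v, hv, not_le.1 hcon⟩
    have h1 := Finset.expect_le_expect (s := Finset.univ) fun ω _ => hpoint ω
    rw [Finset.expect_sub_distrib, Finset.expect_const Finset.univ_nonempty, hswap] at h1
    exact hprob.trans ((sub_le_sub_left hfail _).trans h1)

end Main

end SampledLuby

namespace SampledLuby

/-! ### Logarithmic estimates for the parameters -/

section Constants

theorem one_le_log_of_three_le {N : ℕ} (hN : 3 ≤ N) : 1 ≤ Real.log N := by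
  have h3 : (3 : ℝ) ≤ N := by exact_mod_cast hN
  rw [Real.le_log_iff_exp_le (by linarith)]
  have := Real.exp_one_lt_d9
  linarith

theorem loglog_three_pos : 0 < Real.log (Real.log 3) := by
  refine Real.log_pos ?_
  rw [Real.lt_log_iff_exp_lt (by norm_num)]
  have := Real.exp_one_lt_d9
  linarith

theorem loglog_three_le {N : ℕ} (hN : 3 ≤ N) :
    Real.log (Real.log 3) ≤ Real.log (Real.log N) := by
  have h3 : (3 : ℝ) ≤ N := by exact_mod_cast hN
  have h1 : 1 ≤ Real.log 3 := by exact_mod_cast one_le_log_of_three_le le_rfl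
  exact Real.log_le_log (by linarith) (Real.log_le_log (by norm_num) h3)

theorem clog_sub_one_mul_log_two_le {n : ℕ} (hn : 1 ≤ n) :
    ((Nat.clog 2 n : ℝ) - 1) * Real.log 2 ≤ Real.log n := by
  have hn' : (1 : ℝ) ≤ n := by exact_mod_cast hn
  have hlog : 0 ≤ Real.log n := Real.log_nonneg hn'
  have h2 : 0 < Real.log 2 := Real.log_pos (by norm_num)
  rcases Nat.eq_or_lt_of_le hn with rfl | hlt
  · simp only [Nat.clog_one_right, Nat.cast_zero, Nat.cast_one, Real.log_one]
    linarith
  · have h := Nat.pow_pred_clog_lt_self (b := 2) (by norm_num) hlt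
    have hpos : 1 ≤ Nat.clog 2 n := Nat.clog_pos (by norm_num) hlt
    have h' : ((2 : ℝ) ^ (Nat.clog 2 n - 1)) ≤ n := by exact_mod_cast h.le
    have := Real.log_le_log (by positivity) h'
    rw [Real.log_pow, Nat.cast_sub hpos, Nat.cast_one] at this
    exact this

/-- The number of bits of the random values. -/
noncomputable def valueBits (N : ℕ) : ℕ := Nat.clog 2 (4 * N)

/-- The binary logarithm of the number of steps of one phase. -/
noncomputable def logSteps (N : ℕ) : ℕ := Nat.clog 2 ⌈320 * Real.log N⌉₊

theorem four_mul_le_two_pow_valueBits (N : ℕ) : 4 * N ≤ 2 ^ valueBits N :=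
  Nat.le_pow_clog (by norm_num) _

theorem valueBits_le {N : ℕ} (hN : 3 ≤ N) : (valueBits N : ℝ) ≤ 6 * Real.log N := by
  have h1 := one_le_log_of_three_le hN
  have h := clog_sub_one_mul_log_two_le (n := 4 * N) (by omega)
  have h4 : Real.log ((4 * N : ℕ) : ℝ) = 2 * Real.log 2 + Real.log N := by
    have : (N : ℝ) ≠ 0 := by positivity
    push_cast
    rw [Real.log_mul (by norm_num) this, show (4 : ℝ) = 2 ^ 2 by norm_num, Real.log_pow]
    norm_num
  rw [h4] at h
  have h2 := Real.log_two_gt_d9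
  rw [valueBits]
  by_contra hcon
  push Not at hcon
  nlinarith

theorem le_two_pow_logSteps (N : ℕ) : 320 * Real.log N ≤ 2 ^ logSteps N := by
  refine (Nat.le_ceil _).trans ?_
  exact_mod_cast Nat.le_pow_clog (b := 2) (by norm_num) _

theorem two_pow_logSteps_le {N : ℕ} (hN : 3 ≤ N) :
    (2 : ℝ) ^ logSteps N ≤ 700 * Real.log N := by
  have h1 := one_le_log_of_three_le hN
  have hceil := Nat.ceil_lt_add_one (show 0 ≤ 320 * Real.log N by positivity)
  have hlt : 1 < ⌈320 * Real.log N⌉₊ := by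
    rw [Nat.lt_ceil]
    push_cast
    linarith
  have h := Nat.pow_pred_clog_lt_self (b := 2) (by norm_num) hlt
  have hpos : 1 ≤ logSteps N := Nat.clog_pos (by norm_num) hlt
  have h' : ((2 : ℝ) ^ (logSteps N - 1)) ≤ ⌈320 * Real.log N⌉₊ := by exact_mod_cast h.le
  have hs : (2 : ℝ) ^ logSteps N = 2 * 2 ^ (logSteps N - 1) := by
    rw [← pow_succ', Nat.sub_add_cancel hpos]
  rw [hs]
  linarith

/-- The constant in the bounds on the number of phases and on the energy of one phase. -/
noncomputable def energyConst : ℝ := 14 / Real.log (Real.log 3) + 2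

theorem two_le_energyConst : 2 ≤ energyConst := by
  have := loglog_three_pos
  have h : 0 ≤ 14 / Real.log (Real.log 3) := by positivity
  rw [energyConst]
  linarith

/-- For N ≥ 3 the double logarithm is at least log log 3 > 0, so additive constants can be absorbed
into a factor. -/
theorem fourteen_add_le {N : ℕ} (hN : 3 ≤ N) :
    14 + 2 * Real.log (Real.log N) ≤ energyConst * Real.log (Real.log N) := by
  have h0 := loglog_three_pos
  have h1 := loglog_three_le hN
  rw [energyConst, add_mul]
  have : 14 ≤ 14 / Real.log (Real.log 3) * Real.log (Real.log N) := by
    rw [div_mul_eq_mul_div, le_div_iff₀ h0]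
    linarith
  linarith

theorem logSteps_add_two_le {N : ℕ} (hN : 3 ≤ N) :
    (logSteps N + 2 : ℝ) ≤ energyConst * Real.log (Real.log N) := by
  refine le_trans ?_ (fourteen_add_le hN)
  have hl := one_le_log_of_three_le hN
  have h1 := Real.log_le_log (by positivity) (two_pow_logSteps_le hN)
  rw [Real.log_pow, Real.log_mul (by norm_num) (by linarith)] at h1
  have h2 := Real.log_two_gt_d9
  have h3 : Real.log 700 ≤ 10 * Real.log 2 := by
    have : (10 : ℝ) * Real.log 2 = Real.log (2 ^ 10) := by rw [Real.log_pow]; norm_num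
    rw [this]
    exact Real.log_le_log (by norm_num) (by norm_num)
  have h4 : 0 ≤ Real.log (Real.log N) := Real.log_nonneg hl
  by_contra hcon
  push Not at hcon
  nlinarith

/-- A phase has at least 320 log N steps and 31/32 ≤ e^(-1/32), so the power is at most N^(-10); the
prefactor 2N² ≤ N⁴ costs four powers. -/
theorem phase_failure_le {N : ℕ} (hN : 3 ≤ N) :
    2 * (N : ℝ) ^ 2 * (31 / 32) ^ (2 ^ logSteps N) ≤ 1 / (N : ℝ) ^ 6 := by
  have hN0 : (0 : ℝ) < N := by positivity
  have hN3 : (3 : ℝ) ≤ N := by exact_mod_cast hN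
  have h1 : (31 / 32 : ℝ) ^ (2 ^ logSteps N) ≤ 1 / (N : ℝ) ^ 10 := by
    calc (31 / 32 : ℝ) ^ (2 ^ logSteps N)
        ≤ Real.exp (-(1 / 32)) ^ (2 ^ logSteps N) := by
          refine pow_le_pow_left₀ (by norm_num) ?_ _
          have := Real.add_one_le_exp (-(1 / 32 : ℝ))
          linarith
      _ = Real.exp ((2 : ℝ) ^ logSteps N * (-(1 / 32))) := by
          rw [← Real.exp_nat_mul]; push_cast; rfl
      _ ≤ Real.exp (-(((10 : ℕ) : ℝ) * Real.log N)) := by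
          refine Real.exp_le_exp.2 ?_
          have := le_two_pow_logSteps N
          push_cast
          linarith
      _ = 1 / (N : ℝ) ^ 10 := by
          rw [Real.exp_neg, Real.exp_nat_mul, Real.exp_log hN0, one_div]
  calc 2 * (N : ℝ) ^ 2 * (31 / 32) ^ (2 ^ logSteps N)
      ≤ (N : ℝ) ^ 2 * (N : ℝ) ^ 2 * (1 / (N : ℝ) ^ 10) := by
        gcongr
        nlinarith
    _ = 1 / (N : ℝ) ^ 6 := by
        field_simp

end Constants

/-! ### Parameters of the lemma -/

section OnePhase

/-- The degree bounds of an algorithm with one phase. -/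
noncomputable def onePhaseBound (Δ i : ℕ) : ℕ := if i = 0 then Δ else ⌊(Δ : ℝ) ^ (0.7 : ℝ)⌋₊

/-- With y = Δ^0.7 one has y² = Δ · Δ^0.4. Both exponents exceed 1/3, so Δ ≥ (179200 log N)³
suffices. Here 179200 = 64 · 700 · 4: 700 log N bounds the number of steps, and 4 pays for ⌊y⌋ ≥
y/2. -/
theorem onePhaseBound_spec {N Δ : ℕ} (hN : 3 ≤ N)
    (hΔ : (179200 : ℝ) ^ 3 * Real.log N ^ 20 ≤ Δ) :
    2 ^ logSteps N ≤ onePhaseBound Δ 1 ∧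
      64 * 2 ^ logSteps N * onePhaseBound Δ 0 ≤ onePhaseBound Δ 1 ^ 2 := by
  have hl := one_le_log_of_three_le hN
  have hT := two_pow_logSteps_le hN
  set B : ℝ := 179200 * Real.log N with hB
  have hB1 : 1 ≤ B := by linarith
  have hB3 : B ^ (3 : ℝ) ≤ Δ := by
    refine le_trans (le_of_eq ?_) ((mul_le_mul_of_nonneg_left
      (pow_le_pow_right₀ hl (show 3 ≤ 20 by norm_num)) (by norm_num)).trans hΔ)
    rw [← mul_pow, ← hB]
    exact_mod_cast Real.rpow_natCast B 3
  have hΔ1 : (1 : ℝ) ≤ Δ := (Real.one_le_rpow hB1 (by norm_num)).trans hB3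
  have hpow : ∀ e : ℝ, 0 ≤ e → 1 ≤ 3 * e → B ≤ (Δ : ℝ) ^ e := by
    intro e he0 he
    calc B = B ^ (1 : ℝ) := (Real.rpow_one B).symm
      _ ≤ B ^ (3 * e) := Real.rpow_le_rpow_of_exponent_le hB1 he
      _ = (B ^ (3 : ℝ)) ^ e := Real.rpow_mul (by linarith) _ _
      _ ≤ (Δ : ℝ) ^ e := Real.rpow_le_rpow (by positivity) hB3 he0
  have h4 := hpow 0.4 (by norm_num) (by norm_num)
  have h7 := hpow 0.7 (by norm_num) (by norm_num)
  set y : ℝ := (Δ : ℝ) ^ (0.7 : ℝ) with hy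
  have hfloor : y / 2 ≤ (⌊y⌋₊ : ℝ) := by
    have := Nat.lt_floor_add_one y
    linarith
  have hD0 : onePhaseBound Δ 0 = Δ := rfl
  have hD1 : onePhaseBound Δ 1 = ⌊y⌋₊ := rfl
  rw [hD0, hD1]
  constructor
  · have : (2 : ℝ) ^ logSteps N ≤ (⌊y⌋₊ : ℝ) := by linarith
    exact_mod_cast this
  · have hsq : y ^ 2 = Δ * (Δ : ℝ) ^ (0.4 : ℝ) := by
      rw [hy, ← Real.rpow_natCast, ← Real.rpow_mul (by linarith)]
      nth_rewrite 2 [← Real.rpow_one (Δ : ℝ)]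
      rw [← Real.rpow_add (by linarith)]
      norm_num
    have : 64 * (2 : ℝ) ^ logSteps N * Δ ≤ (⌊y⌋₊ : ℝ) ^ 2 := by
      calc 64 * (2 : ℝ) ^ logSteps N * Δ ≤ (B / 4) * Δ := by
            refine mul_le_mul_of_nonneg_right ?_ (by linarith)
            linarith
        _ ≤ ((Δ : ℝ) ^ (0.4 : ℝ) / 4) * Δ := by gcongr
        _ = (y / 2) ^ 2 := by rw [div_pow, hsq]; ring
        _ ≤ (⌊y⌋₊ : ℝ) ^ 2 := by
            refine pow_le_pow_left₀ (by linarith) hfloor 2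
    exact_mod_cast this

end OnePhase

/-! ### Parameters of the corollary -/

section ManyPhases

/-- The binary logarithm of the initial degree bound. -/
noncomputable def logDegree (N Δ : ℕ) : ℕ := Nat.clog 2 (min Δ N)

/-- The degree bounds of the algorithm that halves the exponent in every phase. -/
noncomputable def phaseBound (N Δ i : ℕ) : ℕ := 2 ^ (logSteps N + 7 + logDegree N Δ / 2 ^ i)

/-- The number of phases. -/
noncomputable def numPhases (N Δ : ℕ) : ℕ := Nat.size (logDegree N Δ)

/-- In exponents, 6 + L + (L + 7 + q) ≤ 2(L + 7 + ⌊q/2⌋). The offset 7 is the least that absorbs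
both the factor 64 and the rounding of q/2. -/
theorem phaseBound_sq (N Δ i : ℕ) :
    64 * 2 ^ logSteps N * phaseBound N Δ i ≤ phaseBound N Δ (i + 1) ^ 2 := by
  have h : logDegree N Δ / 2 ^ (i + 1) = logDegree N Δ / 2 ^ i / 2 := by
    rw [pow_succ, Nat.div_div_eq_div_mul]
  rw [phaseBound, phaseBound, h, show 64 = 2 ^ 6 by norm_num, ← pow_add, ← pow_add, ← pow_mul]
  exact Nat.pow_le_pow_right (by norm_num) (by omega)

theorem phaseBound_last (N Δ : ℕ) : phaseBound N Δ (numPhases N Δ) = 2 ^ logSteps N * 128 := by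
  have : logDegree N Δ / 2 ^ numPhases N Δ = 0 := Nat.div_eq_of_lt (Nat.lt_size_self _)
  rw [phaseBound, this, add_zero, pow_add]
  norm_num

theorem min_le_phaseBound (N Δ : ℕ) : min Δ N ≤ phaseBound N Δ 0 := by
  refine (Nat.le_pow_clog (b := 2) (by norm_num) _).trans ?_
  rw [phaseBound, pow_zero, Nat.div_one]
  exact Nat.pow_le_pow_right (by norm_num) (Nat.le_add_left _ _)

/-- Δ may far exceed N; starting from min(Δ, N) keeps the union bound over phases to a loss of one
factor N. -/
theorem numPhases_le_self (N Δ : ℕ) : numPhases N Δ ≤ N := by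
  have h1 : logDegree N Δ ≤ N :=
    Nat.clog_le_of_le_pow ((min_le_right _ _).trans Nat.lt_two_pow_self.le)
  exact (Nat.size_le.2 Nat.lt_two_pow_self).trans h1

/-- The number of phases is the bit length of `logDegree`, itself at most 4 log Δ. -/
theorem numPhases_le {N Δ : ℕ} (hΔ : 3 ≤ Δ) :
    (numPhases N Δ : ℝ) ≤ energyConst * Real.log (Real.log Δ) := by
  refine le_trans ?_ (fourteen_add_le hΔ)
  have hl := one_le_log_of_three_le hΔ
  have h4 : 0 ≤ Real.log (Real.log Δ) := Real.log_nonneg hl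
  have h2 := Real.log_two_gt_d9
  rcases Nat.eq_zero_or_pos (numPhases N Δ) with h0 | hpos
  · rw [h0, Nat.cast_zero]; linarith
  have hx : (logDegree N Δ : ℝ) ≤ 4 * Real.log Δ := by
    have h := clog_sub_one_mul_log_two_le (n := Δ) (by omega)
    have hmono : (logDegree N Δ : ℝ) ≤ Nat.clog 2 Δ := by
      exact_mod_cast Nat.clog_mono_right 2 (min_le_left Δ N)
    by_contra hcon
    push Not at hcon
    nlinarith
  have hpow : 2 ^ (numPhases N Δ - 1) ≤ logDegree N Δ :=
    Nat.lt_size.1 (by rw [← numPhases]; omega)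
  have hpow' : (2 : ℝ) ^ (numPhases N Δ - 1) ≤ 4 * Real.log Δ :=
    le_trans (by exact_mod_cast hpow) hx
  have h5 := Real.log_le_log (by positivity) hpow'
  rw [Real.log_pow, Real.log_mul (by norm_num) (by linarith), Nat.cast_sub hpos, Nat.cast_one,
    show (4 : ℝ) = 2 ^ 2 by norm_num, Real.log_pow] at h5
  push_cast at h5
  by_contra hcon
  push Not at hcon
  nlinarith

end ManyPhases

end SampledLuby

/-! ### Assembling the lemma and the corollary -/

open SampledLuby in
theorem mainTheorem5 :
    (∃ (c C : ℝ) (A : ℕ → ℕ → SleepingAlgorithm), 0 < c ∧ 0 < C ∧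
      ∀ N Δ : ℕ, 3 ≤ N → c * Real.log N ^ 20 ≤ (Δ : ℝ) →
        ReducesDegree (A N Δ) N Δ
          (bits := C * Real.log N)
          (rounds := C * Real.log N)
          (energy := C * Real.log (Real.log N))
          (prob := 1 - 1 / (N : ℝ) ^ 6)
          (deg := (Δ : ℝ) ^ (0.7 : ℝ))) ∧
    (∃ (C : ℝ) (A : ℕ → ℕ → SleepingAlgorithm), 0 < C ∧
      ∀ N Δ : ℕ, 3 ≤ N → 3 ≤ Δ →
        ReducesDegree (A N Δ) N Δ
          (bits := C * Real.log N)
          (rounds := C * (Real.log N * Real.log (Real.log Δ)))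
          (energy := C * (Real.log (Real.log N) * Real.log (Real.log Δ)))
          (prob := 1 - 1 / (N : ℝ) ^ 5)
          (deg := C * Real.log N ^ 20)) := by
  have hK := two_le_energyConst
  constructor
  · refine ⟨179200 ^ 3, 1400 + energyConst, fun N Δ => algorithm (valueBits N) (logSteps N) 1
      fun i => 2 ^ valueBits N / onePhaseBound Δ (i + 1), by norm_num, by linarith, ?_⟩
    intro N Δ hN hΔ
    have hl := one_le_log_of_three_le hN
    have hll : 0 ≤ Real.log (Real.log N) := Real.log_nonneg hl
    obtain ⟨h1, h2⟩ := onePhaseBound_spec hN hΔ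
    refine reducesDegree_algorithm (onePhaseBound Δ) (four_mul_le_two_pow_valueBits N)
      ?_ ?_ ?_ (min_le_left _ _) ?_ ?_ ?_ ?_ ?_
    · intro i hi
      obtain rfl : i = 0 := by omega
      exact Nat.one_le_two_pow.trans h1
    · intro i hi
      obtain rfl : i = 0 := by omega
      exact h1
    · intro i hi
      obtain rfl : i = 0 := by omega
      exact h2
    · have := valueBits_le hN
      nlinarith
    · have := two_pow_logSteps_le hN
      push_cast
      nlinarith
    · have := logSteps_add_two_le hN
      push_cast
      nlinarith
    · have := phase_failure_le hN
      push_cast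
      linarith
    · exact Nat.floor_le (by positivity)
  -- The summands serve rounds (1400 = 2 · 700), energy and the final degree (89600 = 128 · 700);
  -- the first also covers the message size.
  · refine ⟨1400 * energyConst + energyConst ^ 2 + 89600,
      fun N Δ => algorithm (valueBits N) (logSteps N) (numPhases N Δ)
        fun i => 2 ^ valueBits N / phaseBound N Δ (i + 1), by positivity, ?_⟩
    intro N Δ hN hΔ
    have hl := one_le_log_of_three_le hN
    have hll : 0 ≤ Real.log (Real.log N) := Real.log_nonneg hl
    have hllΔ : 0 ≤ Real.log (Real.log Δ) := Real.log_nonneg (one_le_log_of_three_le hΔ)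
    have hP := numPhases_le (N := N) hΔ
    have hT := two_pow_logSteps_le hN
    refine reducesDegree_algorithm (phaseBound N Δ) (four_mul_le_two_pow_valueBits N)
      (fun i _ => Nat.one_le_two_pow)
      (fun i _ => Nat.pow_le_pow_right (by norm_num) (by rw [add_assoc]; exact Nat.le_add_right _ _))
      (fun i _ => phaseBound_sq N Δ i) (min_le_phaseBound N Δ) ?_ ?_ ?_ ?_ ?_
    · refine (valueBits_le hN).trans (mul_le_mul_of_nonneg_right ?_ (by linarith))
      nlinarith
    · calc 2 * ((numPhases N Δ : ℝ) * 2 ^ logSteps N)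
          ≤ 2 * ((energyConst * Real.log (Real.log Δ)) * (700 * Real.log N)) := by gcongr
        _ = 1400 * energyConst * (Real.log N * Real.log (Real.log Δ)) := by ring
        _ ≤ _ := mul_le_mul_of_nonneg_right (by nlinarith) (by positivity)
    · calc (numPhases N Δ : ℝ) * (logSteps N + 2)
          ≤ (energyConst * Real.log (Real.log Δ)) *
            (energyConst * Real.log (Real.log N)) := by
            gcongr
            exact logSteps_add_two_le hN
        _ = energyConst ^ 2 * (Real.log (Real.log N) * Real.log (Real.log Δ)) := by ring
        _ ≤ _ := mul_le_mul_of_nonneg_right (by nlinarith) (by positivity)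
    · refine sub_le_sub_left ?_ 1
      have hPN : (numPhases N Δ : ℝ) ≤ N := by exact_mod_cast numPhases_le_self N Δ
      have hN0 : (0 : ℝ) < N := by positivity
      calc (numPhases N Δ : ℝ) * (2 * (N : ℝ) ^ 2 * (31 / 32) ^ (2 ^ logSteps N))
          ≤ N * (1 / (N : ℝ) ^ 6) := by
            gcongr
            exact phase_failure_le hN
        _ = 1 / (N : ℝ) ^ 5 := by field_simp
    · rw [phaseBound_last]
      push_cast
      have h20 : Real.log N ≤ Real.log N ^ 20 := le_self_pow₀ hl (by norm_num)
      calc (2 : ℝ) ^ logSteps N * 128 ≤ 89600 * Real.log N := by linarith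
        _ ≤ 89600 * Real.log N ^ 20 := by linarith
        _ ≤ _ := mul_le_mul_of_nonneg_right (by nlinarith) (by positivity)
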